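/- Let $n\ge 0$ be an integer and $\alpha,\eta\in\mathbb C$. Let $M=\mathbb C^{4n+1}$ with coordinates $A_0,\dots,A_{2n},B_1,\dots,B_n,C_1,\dots,C_n$, and put $$A(\lambda)=\alpha\lambda^{2n+1}+A_{2n}\lambda^{2n}+\dots+A_0,\qquad B(\lambda)=\lambda^{2n+1}+B_n\lambda^{2n-1}+\dots+B_1\lambda,\qquad C(\lambda)=C_n\lambda^{2n-1}+\dots+C_1\lambda,$$ $$T(\lambda)=\begin{pmatrix}A(\lambda)&B(\lambda)\\ C(\lambda)&A(-\lambda)\end{pmatrix}.$$ For $k=0,1$ let $\{\cdot,\cdot\}_k$ be the bracket on holomorphic functions on open subsets of $M$, $\{f,g\}_k=\sum_{a,b}\{z_a,z_b\}_k\,\partial_af\,\partial_bg$ (the sums run over the coordinates), in which the brackets of the coordinates are given by the following generating functions and antisymmetry, with $\rho_0=0$ and $\rho_1(\lambda)=\alpha\lambda+A_{2n}$: $$\{B(\lambda),B(\mu)\}_k=0,$$ $$\{A(\lambda),A(\mu)\}_k=\tfrac{\eta}{\lambda+\mu}\bigl(\mu^{2k}B(\lambda)C(\mu)-\lambda^{2k}B(\mu)C(\lambda)\bigr),$$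 $$\{C(\lambda),C(\mu)\}_k=2\eta\bigl(\rho_k(-\mu)A(\mu)-\rho_k(\mu)A(-\mu)\bigr)C(\lambda)-2\eta\bigl(\rho_k(-\lambda)A(\lambda)-\rho_k(\lambda)A(-\lambda)\bigr)C(\mu),$$ $$\{A(\lambda),B(\mu)\}_k=\tfrac{\eta}{\lambda-\mu}\bigl(\lambda^{2k}A(\lambda)B(\mu)-\mu^{2k}A(\mu)B(\lambda)\bigr)+\tfrac{\eta}{\lambda+\mu}\bigl(\lambda^{2k}A(\lambda)B(\mu)+\mu^{2k}A(-\mu)B(\lambda)\bigr)-2\eta\rho_k(\lambda)B(\lambda)B(\mu),$$ $$\{A(\lambda),C(\mu)\}_k=-\tfrac{\eta}{\lambda-\mu}\bigl(\mu^{2k}A(\lambda)C(\mu)-\lambda^{2k}A(\mu)C(\lambda)\bigr)-2\eta k\lambda A(\lambda)C(\mu)-\tfrac{\eta}{\lambda+\mu}\bigl(\mu^{2k}A(\lambda)C(\mu)+\lambda^{2k}A(-\mu)C(\lambda)\bigr)+2\eta\rho_k(\lambda)B(\lambda)C(\mu),$$ $$\{B(\lambda),C(\mu)\}_k=\tfrac{\eta\lambda^{2k}}{\lambda-\mu}\bigl(A(-\lambda)A(\mu)-A(\lambda)A(-\mu)\bigr)+\tfrac{\eta\lambda^{2k}}{\lambda+\mu}\bigl(A(\lambda)A(\mu)-A(-\lambda)A(-\mu)\bigr)+2\eta\bigl(\rho_k(\mu)A(-\mu)-\rho_k(-\mu)A(\mu)\bigr)B(\lambda).$$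 Let $U\subseteq M$ be open and let $$K(\lambda)=\begin{pmatrix}\mathcal A(\lambda)&0\\ \mathcal C(\lambda)&\mathcal D(\lambda)\end{pmatrix},$$ where $\mathcal A,\mathcal D\in\mathbb C[\lambda]$ and $\mathcal C(\lambda)$ is a polynomial in $\lambda$ whose coefficients are holomorphic functions on $U$. Let $\tau(\lambda)=\operatorname{tr}K(\lambda)T(\lambda)=\sum_l\tau_l\lambda^l$. Suppose that $\tau(\lambda)$ has only $n$ independent dynamical coefficients $H_1,\dots,H_n$; that is, the $H_i$ are $n$ of the coefficients $\tau_l$, and at every point of some dense subset of $U$ the differentials $dH_1,\dots,dH_n$ are linearly independent modulo the span of the differentials of the coefficients of $\det T(\lambda)$ (the Casimir functions), while every $d\tau_l$ lies in the span of $dH_1,\dots,dH_n$ and the differentials of the coefficients of $\det T(\lambda)$. Then on $U$ $$\{H_i,H_j\}_0=\{H_i,H_j\}_1=0,\qquad i,j=1,\dots,n.$$ -/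

import Mathlib

open Polynomial

namespace ReflectionAlgebra

noncomputable section

/-! ### The phase space and the matrix `T(λ)` -/

/-- Labels of the `4 n + 1` generators `A_0, …, A_{2n}`, `B_1, …, B_n`, `C_1, …, C_n`
(the label `i : Fin n` of a `B` or a `C` stands for `B_{i+1}` or `C_{i+1}`). -/
abbrev Gen (n : ℕ) : Type := Fin (2 * n + 1) ⊕ (Fin n ⊕ Fin n)

/-- The label of `A_i`. -/
abbrev genA {n : ℕ} (i : Fin (2 * n + 1)) : Gen n := Sum.inl i

/-- The label of `B_{i+1}`. -/
abbrev genB {n : ℕ} (i : Fin n) : Gen n := Sum.inr (Sum.inl i)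

/-- The label of `C_{i+1}`. -/
abbrev genC {n : ℕ} (i : Fin n) : Gen n := Sum.inr (Sum.inr i)

/-- The `(4 n + 1)`-dimensional space with coordinates `A_i`, `B_i`, `C_i`. -/
abbrev Phase (n : ℕ) : Type := Gen n → ℂ

variable {n : ℕ}

/-- `A(λ) = α λ^{2n+1} + A_{2n} λ^{2n} + ⋯ + A_0`. -/
def polyA (α : ℂ) (z : Phase n) : ℂ[X] :=
  C α * X ^ (2 * n + 1) + ∑ i : Fin (2 * n + 1), C (z (genA i)) * X ^ (i : ℕ)

/-- `B(λ) = λ^{2n+1} + B_n λ^{2n-1} + ⋯ + B_1 λ`. -/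
def polyB (z : Phase n) : ℂ[X] :=
  X ^ (2 * n + 1) + ∑ i : Fin n, C (z (genB i)) * X ^ (2 * (i : ℕ) + 1)

/-- `C(λ) = C_n λ^{2n-1} + ⋯ + C_1 λ`. -/
def polyC (z : Phase n) : ℂ[X] :=
  ∑ i : Fin n, C (z (genC i)) * X ^ (2 * (i : ℕ) + 1)

/-- `T(λ)`, with rows `A(λ), B(λ)` and `C(λ), A(-λ)`. -/
def matT (α : ℂ) (z : Phase n) : Matrix (Fin 2) (Fin 2) ℂ[X] :=
  !![polyA α z, polyB z; polyC z, (polyA α z).comp (-X)]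

/-- The coefficient of `λ^l` in `det T(λ)`, as a function on the phase space. -/
def detCoeff (α : ℂ) (l : ℕ) (z : Phase n) : ℂ :=
  (matT α z).det.coeff l

/-! ### The two brackets

Polynomials in `λ` and `μ` are elements of `ℂ[X][X]`: the outer variable is `μ`, the inner one
is `λ`. -/

/-- The variable `λ` of `ℂ[λ][μ]`. -/
def lam : ℂ[X][X] := C X

/-- The variable `μ` of `ℂ[λ][μ]`. -/
def mu : ℂ[X][X] := X

/-- The value `f(x)` of a polynomial `f` at `x = ±λ, ±μ`. -/
def ev (f : ℂ[X]) (x : ℂ[X][X]) : ℂ[X][X] := aeval x f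

/-- The quotient `N / (λ - μ)` (all the divisions below are exact). -/
def divSub (N : ℂ[X][X]) : ℂ[X][X] := -(N /ₘ (X - C X))

/-- The quotient `N / (λ + μ)` (all the divisions below are exact). -/
def divAdd (N : ℂ[X][X]) : ℂ[X][X] := N /ₘ (X - C (-X))

/-- The coefficient of `λ^i μ^j`. -/
def coeff₂ (N : ℂ[X][X]) (i j : ℕ) : ℂ := (N.coeff j).coeff i

/-- `ρ_k(λ)`, the polynomial part of `λ^{2k-1} A(λ) / B(λ)`:
`ρ_0 = 0` and `ρ_1 = α λ + A_{2n}`. -/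
def rho (α : ℂ) (z : Phase n) : Fin 2 → ℂ[X] :=
  ![0, C α * X + C (z (genA (Fin.last (2 * n))))]

/-- `{A(λ), A(μ)}_k`. -/
def brAA (η : ℂ) (k : Fin 2) (z : Phase n) : ℂ[X][X] :=
  η • divAdd
    (mu ^ (2 * (k : ℕ)) * ev (polyB z) lam * ev (polyC z) mu
      - lam ^ (2 * (k : ℕ)) * ev (polyB z) mu * ev (polyC z) lam)

/-- `{C(λ), C(μ)}_k`. -/
def brCC (α η : ℂ) (k : Fin 2) (z : Phase n) : ℂ[X][X] :=
  (2 * η) • ((ev (rho α z k) (-mu) * ev (polyA α z) mu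
      - ev (rho α z k) mu * ev (polyA α z) (-mu)) * ev (polyC z) lam)
    - (2 * η) • ((ev (rho α z k) (-lam) * ev (polyA α z) lam
      - ev (rho α z k) lam * ev (polyA α z) (-lam)) * ev (polyC z) mu)

/-- `{A(λ), B(μ)}_k`. -/
def brAB (α η : ℂ) (k : Fin 2) (z : Phase n) : ℂ[X][X] :=
  η • divSub
    (lam ^ (2 * (k : ℕ)) * ev (polyA α z) lam * ev (polyB z) mu
      - mu ^ (2 * (k : ℕ)) * ev (polyA α z) mu * ev (polyB z) lam)
    + η • divAdd
      (lam ^ (2 * (k : ℕ)) * ev (polyA α z) lam * ev (polyB z) mu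
        + mu ^ (2 * (k : ℕ)) * ev (polyA α z) (-mu) * ev (polyB z) lam)
    - (2 * η) • (ev (rho α z k) lam * ev (polyB z) lam * ev (polyB z) mu)

/-- `{A(λ), C(μ)}_k`. -/
def brAC (α η : ℂ) (k : Fin 2) (z : Phase n) : ℂ[X][X] :=
  -(η • divSub
      (mu ^ (2 * (k : ℕ)) * ev (polyA α z) lam * ev (polyC z) mu
        - lam ^ (2 * (k : ℕ)) * ev (polyA α z) mu * ev (polyC z) lam))
    - (2 * η * ((k : ℕ) : ℂ)) • (lam * ev (polyA α z) lam * ev (polyC z) mu)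
    - η • divAdd
      (mu ^ (2 * (k : ℕ)) * ev (polyA α z) lam * ev (polyC z) mu
        + lam ^ (2 * (k : ℕ)) * ev (polyA α z) (-mu) * ev (polyC z) lam)
    + (2 * η) • (ev (rho α z k) lam * ev (polyB z) lam * ev (polyC z) mu)

/-- `{B(λ), C(μ)}_k`. -/
def brBC (α η : ℂ) (k : Fin 2) (z : Phase n) : ℂ[X][X] :=
  η • (lam ^ (2 * (k : ℕ)) * divSub
      (ev (polyA α z) (-lam) * ev (polyA α z) mu - ev (polyA α z) lam * ev (polyA α z) (-mu)))
    + η • (lam ^ (2 * (k : ℕ)) * divAdd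
      (ev (polyA α z) lam * ev (polyA α z) mu
        - ev (polyA α z) (-lam) * ev (polyA α z) (-mu)))
    + (2 * η) • ((ev (rho α z k) mu * ev (polyA α z) (-mu)
      - ev (rho α z k) (-mu) * ev (polyA α z) mu) * ev (polyB z) lam)

/-- The brackets `{·,·}_k` of the generators, read off as coefficients of the generating
functions above; `{B_i, B_j}_k = 0`, and the missing cases are given by antisymmetry. -/
def tensor (α η : ℂ) (k : Fin 2) (z : Phase n) : Gen n → Gen n → ℂ
  | .inl i, .inl j => coeff₂ (brAA η k z) i j
  | .inl i, .inr (.inl j) => coeff₂ (brAB α η k z) i (2 * j + 1)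
  | .inl i, .inr (.inr j) => coeff₂ (brAC α η k z) i (2 * j + 1)
  | .inr (.inl i), .inl j => -coeff₂ (brAB α η k z) j (2 * i + 1)
  | .inr (.inl _), .inr (.inl _) => 0
  | .inr (.inl i), .inr (.inr j) => coeff₂ (brBC α η k z) (2 * i + 1) (2 * j + 1)
  | .inr (.inr i), .inl j => -coeff₂ (brAC α η k z) j (2 * i + 1)
  | .inr (.inr i), .inr (.inl j) => -coeff₂ (brBC α η k z) (2 * j + 1) (2 * i + 1)
  | .inr (.inr i), .inr (.inr j) => coeff₂ (brCC α η k z) (2 * i + 1) (2 * j + 1)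

/-- The partial derivative of `f` in the coordinate labelled `a`. -/
def partialDeriv (a : Gen n) (f : Phase n → ℂ) (z : Phase n) : ℂ :=
  fderiv ℂ f z (Pi.single a 1)

/-- The bracket `{f, g}_k` of two functions on the phase space, for `k = 0, 1`. -/
def bracket (α η : ℂ) (k : Fin 2) (f g : Phase n → ℂ) (z : Phase n) : ℂ :=
  ∑ a, ∑ b, tensor α η k z a b * partialDeriv a f z * partialDeriv b g z

/-! ### The boundary matrix and the integrals -/

/-- The lower-triangular boundary matrix `K(λ)`: its diagonal consists of numerical polynomials,
the coefficients of `c` may be functions on the phase space. -/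
def matK (a d : ℂ[X]) (c : (Phase n → ℂ)[X]) (z : Phase n) : Matrix (Fin 2) (Fin 2) ℂ[X] :=
  !![a, 0; c.map (Pi.evalRingHom (fun _ : Phase n => ℂ) z), d]

/-- The coefficient `τ_l` of `λ^l` in `τ(λ) = tr K(λ) T(λ)`, as a function on the phase space. -/
def tauCoeff (α : ℂ) (a d : ℂ[X]) (c : (Phase n → ℂ)[X]) (l : ℕ) (z : Phase n) : ℂ :=
  (matK a d c z * matT α z).trace.coeff l

/-- The span, at a point, of the differentials of the coefficients of `det T(λ)`. -/
def casimirSpan (α : ℂ) (z : Phase n) : Submodule ℂ (Phase n →L[ℂ] ℂ) :=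
  Submodule.span ℂ (Set.range fun l : ℕ => fderiv ℂ (detCoeff (n := n) α l) z)

/-- The functions `H_1, …, H_n` are independent at `z` (modulo the Casimir functions, that is, as
functions on the common level set of the Casimir functions). -/
def IndependentAt (α : ℂ) (H : Fin n → Phase n → ℂ) (z : Phase n) : Prop :=
  LinearIndependent ℂ fun i => (casimirSpan α z).mkQ (fderiv ℂ (H i) z)

/-- The function `f` is dependent at `z` on `H_1, …, H_n` and the Casimir functions. -/
def DependentAt (α : ℂ) (H : Fin n → Phase n → ℂ) (f : Phase n → ℂ) (z : Phase n) : Prop :=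
  fderiv ℂ f z ∈ casimirSpan α z ⊔ Submodule.span ℂ (Set.range fun i => fderiv ℂ (H i) z)

/-- On the open set `U`, the coefficients `τ_{e 1}, …, τ_{e n}` are the only independent
dynamical coefficients of `τ(λ)`: at the points of a dense subset of `U` they are independent
modulo the Casimir functions, and every coefficient of `τ(λ)` depends on them and on the Casimir
functions. -/
def OnlyIndependentCoeffs (α : ℂ) (a d : ℂ[X]) (c : (Phase n → ℂ)[X]) (e : Fin n → ℕ)
    (U : Set (Phase n)) : Prop :=
  U ⊆ closure {z | z ∈ U ∧ IndependentAt α (fun i => tauCoeff α a d c (e i)) z ∧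
    ∀ l : ℕ, DependentAt α (fun i => tauCoeff α a d c (e i)) (tauCoeff α a d c l) z}

end

end ReflectionAlgebra

/-
Separation of variables. At a generic point the zeros of `B(λ)` are `0` and `±r_1, …, ±r_n`, the
squares `r_j²` being distinct and nonzero. For both brackets the generating functions show that
covectors `s dA(r_j) + t dB(r_j)` attached to different `r_j` are in involution. Eliminating
`dA(-r_j)` between `dτ(r_j)` and the Casimir differential `d det T(r_j)` gives one such covector for
each `j`. These `n` covectors are independent modulo the Casimir differentials, because `dA(r_j)`
and `dB(r_j)` pair nontrivially under the bracket with `k = 0`, `η = 1`. Hence, by a dimension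
count, they span all the `dτ_l` modulo the Casimirs, so the `τ_l` commute at such a point, and
everywhere by continuity.

If `𝒜 = 𝒟 = 0`, this combination may vanish, but then `τ = 𝒞 B`: each `r_j` is a root of `τ`, and
implicit differentiation puts `dr_j`, which is proportional to `dB(r_j)`, in the span of the `dτ_l`.
-/

namespace ReflectionAlgebra

noncomputable section

variable {n : ℕ}

lemma mem_of_forall_sum_pow_smul_mem {K ι V : Type*} [Field K] [Fintype ι] [AddCommGroup V]
    [Module K V] {f : ι → ℕ} (hf : Function.Injective f) {v : ι → V} {p : Submodule K V}
    {T : Set K} (hT : T.Infinite) (h : ∀ x ∈ T, ∑ i, x ^ f i • v i ∈ p) (i : ι) : v i ∈ p := by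
  rw [← Submodule.Quotient.mk_eq_zero, ← Module.forall_dual_apply_eq_zero_iff K]
  intro φ
  have hzero : ∑ j, C (φ (p.mkQ (v j))) * X ^ f j = 0 := by
    refine eq_zero_of_infinite_isRoot _ (hT.mono fun x hx => ?_)
    have hx : φ (p.mkQ (∑ j, x ^ f j • v j)) = 0 := by
      rw [Submodule.mkQ_apply, (Submodule.Quotient.mk_eq_zero p).2 (h x hx), map_zero]
    simpa only [Set.mem_ofPred_eq, IsRoot, eval_finsetSum, eval_mul, eval_C, eval_pow, eval_X,
      map_sum, map_smul, smul_eq_mul, mul_comm] using hx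
  classical
  simpa [finsetSum_coeff, coeff_X_pow, hf.eq_iff] using congrArg (coeff · (f i)) hzero

/-- The polynomials all of whose exponents are values of `f`. -/
def supportedOn (R : Type*) [Semiring R] {ι : Type*} (f : ι → ℕ) : Submodule R R[X] where
  carrier := {p | ∀ j ∉ Set.range f, p.coeff j = 0}
  add_mem' hp hq j hj := by rw [coeff_add, hp j hj, hq j hj, add_zero]
  zero_mem' _ _ := coeff_zero _
  smul_mem' c p hp j hj := by rw [coeff_smul, hp j hj, smul_zero]

lemma sum_C_mul_X_pow_mem_supportedOn {R ι : Type*} [Semiring R] [Fintype ι] (f : ι → ℕ)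
    (v : ι → R) : ∑ i, C (v i) * X ^ f i ∈ supportedOn R f := by
  intro j hj
  rw [finsetSum_coeff]
  refine Finset.sum_eq_zero fun i _ => ?_
  rw [coeff_C_mul_X_pow, if_neg fun h => hj ⟨i, h.symm⟩]

lemma X_pow_mul_mem_supportedOn {R ι κ : Type*} [Semiring R] {f : ι → ℕ} {g : κ → ℕ} {m : ℕ}
    (h : ∀ i, f i + m ∈ Set.range g) {p : R[X]} (hp : p ∈ supportedOn R f) :
    X ^ m * p ∈ supportedOn R g := by
  intro j hj
  rw [coeff_X_pow_mul']
  split_ifs with hmj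
  · refine hp _ ?_
    rintro ⟨i, hi⟩
    exact hj (by simpa [hi, hmj] using h i)
  · rfl

lemma eval_eq_sum_of_mem_supportedOn {R ι : Type*} [Semiring R] [Fintype ι] {f : ι → ℕ}
    (hf : Function.Injective f) {p : R[X]} (hp : p ∈ supportedOn R f) (x : R) :
    p.eval x = ∑ i, p.coeff (f i) * x ^ f i := by
  classical
  rw [eval_eq_sum, Polynomial.sum, ← Finset.sum_image (f := fun j => p.coeff j * x ^ j) hf.injOn]
  refine Finset.sum_subset (fun j hj => ?_) fun j _ hj => by simp [notMem_support_iff.1 hj]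
  by_contra hcon
  exact mem_support_iff.1 hj (hp j (by simpa using hcon))

/-- Dividing by `x² - λ²` lowers exponents by `2`: the coefficients of the quotient satisfy
`p_j = x² p_{j+2} - E_{j+2}`. -/
lemma coeff_eq_zero_of_mul_sq_sub_sq {R : Type*} [CommRing R] {p E : R[X]} {x : R}
    (h : p * (C x ^ 2 - X ^ 2) = E) {j : ℕ} (hE : ∀ m, E.coeff (j + 2 * m + 2) = 0) :
    p.coeff j = 0 := by
  have hrec : ∀ m, p.coeff j = x ^ (2 * m) * p.coeff (j + 2 * m) := by
    intro m
    induction m with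
    | zero => simp
    | succ m ih =>
      have hcoeff := hE m
      rw [← h, mul_sub, coeff_sub, coeff_mul_X_pow, ← C_pow, coeff_mul_C, sub_eq_zero] at hcoeff
      rw [ih, ← hcoeff, mul_add, pow_add]
      ring_nf
  rw [hrec (p.natDegree + 1), coeff_eq_zero_of_natDegree_lt (by lia), mul_zero]

lemma evalEval_eq_sum {ι κ : Type*} [Fintype ι] [Fintype κ] {f : ι → ℕ} {g : κ → ℕ}
    (hf : Function.Injective f) (hg : Function.Injective g) {N : ℂ[X][X]}
    (hN₁ : ∀ y, N.eval (C y) ∈ supportedOn ℂ f)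
    (hN₂ : ∀ x, N.map (evalRingHom x) ∈ supportedOn ℂ g) (x y : ℂ) :
    N.evalEval x y = ∑ a, ∑ b, coeff₂ N (f a) (g b) * x ^ f a * y ^ g b := by
  rw [evalEval, eval_eq_sum_of_mem_supportedOn hf (hN₁ y)]
  refine Finset.sum_congr rfl fun a _ => ?_
  have hN : N ∈ supportedOn ℂ[X] g := fun j hj =>
    Polynomial.funext fun x => by simpa using hN₂ x j hj
  rw [eval_eq_sum_of_mem_supportedOn hg hN, finsetSum_coeff, Finset.sum_mul]
  refine Finset.sum_congr rfl fun b _ => ?_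
  rw [← C_pow, coeff_mul_C, coeff₂]
  ring

lemma mem_supportedOn_of_mul_sq_sub_sq {R ι κ : Type*} [CommRing R] {f : ι → ℕ} {g : κ → ℕ}
    (hfg : ∀ j m, j + 2 * m + 2 ∈ Set.range g → j ∈ Set.range f) {p E : R[X]} {x : R}
    (hE : E ∈ supportedOn R g) (h : p * (C x ^ 2 - X ^ 2) = E) : p ∈ supportedOn R f :=
  fun j hj => coeff_eq_zero_of_mul_sq_sub_sq h fun m => hE _ fun hm => hj (hfg j m hm)

lemma evalEval_eq_sum_of_mul_sq_sub_sq {ι κ ι' κ' σ : Type*} [Fintype ι] [Fintype κ] [Fintype σ]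
    {f : ι → ℕ} {g : κ → ℕ} {f' : ι' → ℕ} {g' : κ' → ℕ}
    (hf : Function.Injective f) (hg : Function.Injective g)
    (hff' : ∀ j m, j + 2 * m + 2 ∈ Set.range f' → j ∈ Set.range f)
    (hgg' : ∀ j m, j + 2 * m + 2 ∈ Set.range g' → j ∈ Set.range g)
    {N : ℂ[X][X]} {c : ℂ} {p q : σ → ℂ[X]}
    (hp : ∀ i, p i ∈ supportedOn ℂ f') (hq : ∀ i, q i ∈ supportedOn ℂ g')
    (hN : ∀ x y, N.evalEval x y * (x ^ 2 - y ^ 2) = c * ∑ i, (p i).eval x * (q i).eval y)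
    (x y : ℂ) :
    N.evalEval x y = ∑ a, ∑ b, coeff₂ N (f a) (g b) * x ^ f a * y ^ g b := by
  refine evalEval_eq_sum hf hg (fun y => ?_) (fun x => ?_) x y
  · refine mem_supportedOn_of_mul_sq_sub_sq hff' (x := y) (E := -c • ∑ i, (q i).eval y • p i)
      (Submodule.smul_mem _ _ <| sum_mem fun i _ => Submodule.smul_mem _ _ (hp i))
      (Polynomial.funext fun x => ?_)
    have := hN x y
    simp only [evalEval] at this
    simp only [eval_mul, eval_sub, eval_pow, eval_C, eval_X, eval_finsetSum, eval_smul,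
      smul_eq_mul, mul_comm (eval y _)]
    linear_combination -this
  · refine mem_supportedOn_of_mul_sq_sub_sq hgg' (x := x) (E := c • ∑ i, (p i).eval x • q i)
      (Submodule.smul_mem _ _ <| sum_mem fun i _ => Submodule.smul_mem _ _ (hq i))
      (Polynomial.funext fun y => ?_)
    simp only [eval_mul, eval_sub, eval_pow, eval_C, eval_X, eval_finsetSum, eval_smul,
      smul_eq_mul]
    rw [← hN x y, eval_map, eval₂_evalRingHom]

@[simp]
lemma evalEval_lam (x y : ℂ) : lam.evalEval x y = x := by
  rw [lam, evalEval_C, eval_X]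

@[simp]
lemma evalEval_mu (x y : ℂ) : mu.evalEval x y = y := evalEval_X x y

@[simp]
lemma evalEval_ev (f : ℂ[X]) (p : ℂ[X][X]) (x y : ℂ) :
    (ev f p).evalEval x y = f.eval (p.evalEval x y) := by
  rw [ev, ← coe_aevalAeval_eq_evalEval, ← aeval_algHom_apply]
  rfl

lemma eval_eval_eq_evalEval (N : ℂ[X][X]) (p : ℂ[X]) (t : ℂ) :
    (N.eval p).eval t = N.evalEval t (p.eval t) := by
  rw [← coe_evalRingHom t, ← eval₂_hom, eval₂_evalRingHom]

lemma evalEval_divSub_mul {N : ℂ[X][X]} (h : ∀ x, N.evalEval x x = 0) (x y : ℂ) :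
    (divSub N).evalEval x y * (x - y) = N.evalEval x y := by
  have hN : N.eval X = 0 := Polynomial.funext fun t => by
    rw [eval_eval_eq_evalEval, eval_X, h, eval_zero]
  have := congrArg (evalEval x y) ((mul_divByMonic_eq_iff_isRoot (p := N)).2 hN)
  simp only [evalEval_mul, evalEval_sub, evalEval_X, evalEval_C, eval_X] at this
  rw [divSub, evalEval_neg]
  linear_combination this

lemma evalEval_divAdd_mul {N : ℂ[X][X]} (h : ∀ x, N.evalEval x (-x) = 0) (x y : ℂ) :
    (divAdd N).evalEval x y * (x + y) = N.evalEval x y := by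
  have hN : N.eval (-X) = 0 := Polynomial.funext fun t => by
    rw [eval_eval_eq_evalEval, eval_neg, eval_X, h, eval_zero]
  have := congrArg (evalEval x y) ((mul_divByMonic_eq_iff_isRoot (p := N)).2 hN)
  simp only [evalEval_mul, evalEval_sub, evalEval_X, evalEval_C, eval_X, eval_neg] at this
  rw [divAdd]
  linear_combination this

lemma eval_polyB_neg (z : Phase n) (x : ℂ) : (polyB z).eval (-x) = -(polyB z).eval x := by
  simp only [polyB, eval_add, eval_pow, eval_X, eval_finsetSum, eval_mul, eval_C,
    (odd_two_mul_add_one _).neg_pow, mul_neg, Finset.sum_neg_distrib, neg_add]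

lemma eval_polyC_neg (z : Phase n) (x : ℂ) : (polyC z).eval (-x) = -(polyC z).eval x := by
  simp [polyC, eval_finsetSum, (odd_two_mul_add_one _).neg_pow]

lemma eval_rho (α : ℂ) (z : Phase n) (k : Fin 2) (x : ℂ) :
    (rho α z k).eval x = (k : ℕ) * (α * x + z (genA (Fin.last (2 * n)))) := by
  fin_cases k <;> simp [rho]

lemma evalEval_brAA_mul (η : ℂ) (k : Fin 2) (z : Phase n) (x y : ℂ) :
    (brAA η k z).evalEval x y * (x + y) =
      η * (y ^ (2 * (k : ℕ)) * (polyB z).eval x * (polyC z).eval y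
        - x ^ (2 * (k : ℕ)) * (polyB z).eval y * (polyC z).eval x) := by
  rw [brAA, evalEval_smul, smul_mul_assoc, evalEval_divAdd_mul]
  · simp
  · intro x
    simp [eval_polyB_neg, eval_polyC_neg, (even_two_mul _).neg_pow]

lemma evalEval_brAB_mul (α η : ℂ) (k : Fin 2) (z : Phase n) (x y : ℂ) :
    (brAB α η k z).evalEval x y * (x ^ 2 - y ^ 2) =
      η * (x + y) * (x ^ (2 * (k : ℕ)) * (polyA α z).eval x * (polyB z).eval y
          - y ^ (2 * (k : ℕ)) * (polyA α z).eval y * (polyB z).eval x)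
        + η * (x - y) * (x ^ (2 * (k : ℕ)) * (polyA α z).eval x * (polyB z).eval y
          + y ^ (2 * (k : ℕ)) * (polyA α z).eval (-y) * (polyB z).eval x)
        - 2 * η * (rho α z k).eval x * (polyB z).eval x * (polyB z).eval y
          * (x ^ 2 - y ^ 2) := by
  have hsub := evalEval_divSub_mul
    (N := lam ^ (2 * (k : ℕ)) * ev (polyA α z) lam * ev (polyB z) mu
      - mu ^ (2 * (k : ℕ)) * ev (polyA α z) mu * ev (polyB z) lam) (fun x => by simp) x y
  have hadd := evalEval_divAdd_mul
    (N := lam ^ (2 * (k : ℕ)) * ev (polyA α z) lam * ev (polyB z) mu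
        + mu ^ (2 * (k : ℕ)) * ev (polyA α z) (-mu) * ev (polyB z) lam)
    (fun x => by simp [eval_polyB_neg, (even_two_mul _).neg_pow]) x y
  simp only [brAB, evalEval_add, evalEval_sub, evalEval_mul, evalEval_smul, evalEval_neg,
    evalEval_pow, evalEval_ev, evalEval_lam, evalEval_mu, smul_eq_mul] at hsub hadd ⊢
  linear_combination η * (x + y) * hsub + η * (x - y) * hadd

lemma evalEval_brAC_mul (α η : ℂ) (k : Fin 2) (z : Phase n) (x y : ℂ) :
    (brAC α η k z).evalEval x y * (x ^ 2 - y ^ 2) =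
      -(η * (x + y) * (y ^ (2 * (k : ℕ)) * (polyA α z).eval x * (polyC z).eval y
          - x ^ (2 * (k : ℕ)) * (polyA α z).eval y * (polyC z).eval x))
        - 2 * η * (k : ℕ) * x * (polyA α z).eval x * (polyC z).eval y * (x ^ 2 - y ^ 2)
        - η * (x - y) * (y ^ (2 * (k : ℕ)) * (polyA α z).eval x * (polyC z).eval y
          + x ^ (2 * (k : ℕ)) * (polyA α z).eval (-y) * (polyC z).eval x)
        + 2 * η * (rho α z k).eval x * (polyB z).eval x * (polyC z).eval y
          * (x ^ 2 - y ^ 2) := by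
  have hsub := evalEval_divSub_mul
    (N := mu ^ (2 * (k : ℕ)) * ev (polyA α z) lam * ev (polyC z) mu
        - lam ^ (2 * (k : ℕ)) * ev (polyA α z) mu * ev (polyC z) lam) (fun x => by simp) x y
  have hadd := evalEval_divAdd_mul
    (N := mu ^ (2 * (k : ℕ)) * ev (polyA α z) lam * ev (polyC z) mu
        + lam ^ (2 * (k : ℕ)) * ev (polyA α z) (-mu) * ev (polyC z) lam)
    (fun x => by simp [eval_polyC_neg, (even_two_mul _).neg_pow]) x y
  simp only [brAC, evalEval_add, evalEval_sub, evalEval_mul, evalEval_smul, evalEval_neg,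
    evalEval_pow, evalEval_ev, evalEval_lam, evalEval_mu, smul_eq_mul] at hsub hadd ⊢
  linear_combination -η * (x + y) * hsub - η * (x - y) * hadd

lemma evalEval_brBC_mul (α η : ℂ) (k : Fin 2) (z : Phase n) (x y : ℂ) :
    (brBC α η k z).evalEval x y * (x ^ 2 - y ^ 2) =
      η * x ^ (2 * (k : ℕ)) * (x + y) * ((polyA α z).eval (-x) * (polyA α z).eval y
          - (polyA α z).eval x * (polyA α z).eval (-y))
        + η * x ^ (2 * (k : ℕ)) * (x - y) * ((polyA α z).eval x * (polyA α z).eval y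
          - (polyA α z).eval (-x) * (polyA α z).eval (-y))
        + 2 * η * ((rho α z k).eval y * (polyA α z).eval (-y)
          - (rho α z k).eval (-y) * (polyA α z).eval y) * (polyB z).eval x
          * (x ^ 2 - y ^ 2) := by
  have hsub := evalEval_divSub_mul
    (N := ev (polyA α z) (-lam) * ev (polyA α z) mu - ev (polyA α z) lam * ev (polyA α z) (-mu))
    (fun x => by simp [mul_comm]) x y
  have hadd := evalEval_divAdd_mul
    (N := ev (polyA α z) lam * ev (polyA α z) mu - ev (polyA α z) (-lam) * ev (polyA α z) (-mu))
    (fun x => by simp [mul_comm]) x y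
  simp only [brBC, evalEval_add, evalEval_sub, evalEval_mul, evalEval_smul, evalEval_neg,
    evalEval_pow, evalEval_ev, evalEval_lam, evalEval_mu, smul_eq_mul] at hsub hadd ⊢
  linear_combination η * x ^ (2 * (k : ℕ)) * ((x + y) * hsub + (x - y) * hadd)

lemma evalEval_brCC (α η : ℂ) (k : Fin 2) (z : Phase n) (x y : ℂ) :
    (brCC α η k z).evalEval x y =
      2 * η * ((rho α z k).eval (-y) * (polyA α z).eval y
          - (rho α z k).eval y * (polyA α z).eval (-y)) * (polyC z).eval x
        - 2 * η * ((rho α z k).eval (-x) * (polyA α z).eval x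
          - (rho α z k).eval x * (polyA α z).eval (-x)) * (polyC z).eval y := by
  simp only [brCC, evalEval_sub, evalEval_mul, evalEval_smul, evalEval_neg, evalEval_ev,
    evalEval_lam, evalEval_mu, smul_eq_mul]
  ring

lemma sum_fin_two_mul {M : Type*} [AddCommMonoid M] {m : ℕ} (f : Fin (2 * m) → M) :
    ∑ i, f i = ∑ i : Fin m, (f ⟨2 * i, by lia⟩ + f ⟨2 * i + 1, by lia⟩) := by
  induction m with
  | zero => rfl
  | succ m ih =>
    calc ∑ i : Fin (2 * m + 1 + 1), f i
        = (∑ i : Fin (2 * m), f ⟨i, by lia⟩ + f ⟨2 * m, by lia⟩) + f ⟨2 * m + 1, by lia⟩ := by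
          rw [Fin.sum_univ_castSucc, Fin.sum_univ_castSucc]
          rfl
      _ = _ := by
          rw [ih fun i => f ⟨i, by lia⟩, Fin.sum_univ_castSucc, add_assoc]
          rfl

/-- The remainder of the odd part of `A(λ)` modulo `B(λ)`. -/
def oddRem (α : ℂ) (z : Phase n) : ℂ[X] :=
  ∑ i : Fin n, C (z (genA ⟨2 * i + 1, by lia⟩) - α * z (genB i)) * X ^ (2 * (i : ℕ) + 1)

/-- The remainder modulo `B(λ)` of `λ` times the even part of `A(λ)`. -/
def evenRem (z : Phase n) : ℂ[X] :=
  ∑ i : Fin n, C (z (genA ⟨2 * i, by lia⟩) - z (genA (Fin.last _)) * z (genB i))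
    * X ^ (2 * (i : ℕ) + 1)

lemma eval_polyA_eq_add (α : ℂ) (z : Phase n) (x : ℂ) :
    (polyA α z).eval x = (α * x ^ (2 * n + 1)
        + ∑ i : Fin n, z (genA ⟨2 * i + 1, by lia⟩) * x ^ (2 * (i : ℕ) + 1))
      + (z (genA (Fin.last _)) * x ^ (2 * n)
        + ∑ i : Fin n, z (genA ⟨2 * i, by lia⟩) * x ^ (2 * (i : ℕ))) := by
  simp only [polyA, eval_add, eval_mul, eval_C, eval_pow, eval_X, eval_finsetSum,
    Fin.sum_univ_castSucc (n := 2 * n), sum_fin_two_mul, Finset.sum_add_distrib, Fin.val_castSucc,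
    Fin.val_last, Fin.castSucc_mk]
  ring

lemma eval_polyA_sub_eval_neg (α : ℂ) (z : Phase n) (x : ℂ) :
    (polyA α z).eval x - (polyA α z).eval (-x) =
      2 * ((oddRem α z).eval x + α * (polyB z).eval x) := by
  simp only [eval_polyA_eq_add, oddRem, polyB, eval_finsetSum, eval_add, eval_mul, eval_C, eval_pow,
    eval_X, sub_mul, Finset.sum_sub_distrib, (odd_two_mul_add_one _).neg_pow,
    (even_two_mul _).neg_pow, mul_neg, Finset.sum_neg_distrib, mul_assoc, ← Finset.mul_sum]
  ring

lemma mul_eval_polyA_add_eval_neg (α : ℂ) (z : Phase n) (x : ℂ) :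
    x * ((polyA α z).eval x + (polyA α z).eval (-x)) =
      2 * ((evenRem z).eval x + z (genA (Fin.last _)) * (polyB z).eval x) := by
  simp only [eval_polyA_eq_add, evenRem, polyB, eval_finsetSum, eval_add, eval_mul, eval_C,
    eval_pow, eval_X, sub_mul, Finset.sum_sub_distrib, (odd_two_mul_add_one _).neg_pow,
    (even_two_mul _).neg_pow, mul_neg, Finset.sum_neg_distrib, mul_assoc, ← Finset.mul_sum,
    pow_succ, mul_comm _ x, mul_left_comm _ x]
  ring

lemma pow_two_mul_sub_pow_two_mul (k : Fin 2) (x y : ℂ) :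
    x ^ (2 * (k : ℕ)) - y ^ (2 * (k : ℕ)) = (k : ℕ) * (x ^ 2 - y ^ 2) := by
  fin_cases k <;> simp

lemma evalEval_brAB_mul_eq_rem (α η : ℂ) (k : Fin 2) (z : Phase n) (x y : ℂ) :
    (brAB α η k z).evalEval x y * (x ^ 2 - y ^ 2) =
      2 * η * (x ^ (2 * (k : ℕ)) * (evenRem z).eval x * (polyB z).eval y
        + x ^ (2 * (k : ℕ) + 1) * (oddRem α z).eval x * (polyB z).eval y
        - (polyB z).eval x * (y ^ (2 * (k : ℕ)) * (evenRem z).eval y)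
        - x * (polyB z).eval x * (y ^ (2 * (k : ℕ)) * (oddRem α z).eval y)) := by
  rw [evalEval_brAB_mul, eval_rho]
  linear_combination
    η * x ^ (2 * (k : ℕ)) * (polyB z).eval y * (mul_eval_polyA_add_eval_neg α z x
        + x * eval_polyA_sub_eval_neg α z x)
      - η * y ^ (2 * (k : ℕ)) * (polyB z).eval x * (mul_eval_polyA_add_eval_neg α z y
        + x * eval_polyA_sub_eval_neg α z y)
      + 2 * η * (α * x + z (genA (Fin.last _))) * (polyB z).eval x * (polyB z).eval y
        * pow_two_mul_sub_pow_two_mul k x y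

lemma evalEval_brAC_mul_eq_rem (α η : ℂ) (k : Fin 2) (z : Phase n) (x y : ℂ) :
    (brAC α η k z).evalEval x y * (x ^ 2 - y ^ 2) =
      -2 * η * (x ^ (2 * (k : ℕ)) * ((evenRem z).eval x + x * (oddRem α z).eval x)
          * (polyC z).eval y
        + (α * x + z (genA (Fin.last _))) * (polyB z).eval x
          * (y ^ (2 * (k : ℕ)) * (polyC z).eval y)
        - x ^ (2 * (k : ℕ)) * (polyC z).eval x * ((evenRem z).eval y
          + z (genA (Fin.last _)) * (polyB z).eval y)
        - x ^ (2 * (k : ℕ) + 1) * (polyC z).eval x * ((oddRem α z).eval y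
          + α * (polyB z).eval y)) := by
  rw [evalEval_brAC_mul, eval_rho]
  linear_combination
    -η * x ^ (2 * (k : ℕ)) * (polyC z).eval y * (mul_eval_polyA_add_eval_neg α z x
        + x * eval_polyA_sub_eval_neg α z x)
      + η * x ^ (2 * (k : ℕ)) * (polyC z).eval x * (mul_eval_polyA_add_eval_neg α z y
        + x * eval_polyA_sub_eval_neg α z y)
      + 2 * η * ((polyA α z).eval x * x - (α * x + z (genA (Fin.last _))) * (polyB z).eval x)
        * (polyC z).eval y * pow_two_mul_sub_pow_two_mul k x y

lemma evalEval_brBC_mul_eq_rem (α η : ℂ) (k : Fin 2) (z : Phase n) (x y : ℂ) :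
    (brBC α η k z).evalEval x y * (x ^ 2 - y ^ 2) =
      4 * η * (x ^ (2 * (k : ℕ)) * ((evenRem z).eval x * (oddRem α z).eval y
          - (oddRem α z).eval x * (evenRem z).eval y
          + (α * (evenRem z).eval x - z (genA (Fin.last _)) * (oddRem α z).eval x)
            * (polyB z).eval y)
        - (polyB z).eval x * (y ^ (2 * (k : ℕ)) * (α * (evenRem z).eval y
          - z (genA (Fin.last _)) * (oddRem α z).eval y))) := by
  rw [evalEval_brBC_mul]
  simp only [eval_rho]
  linear_combination
    η * x ^ (2 * (k : ℕ)) * (((polyA α z).eval y - (polyA α z).eval (-y))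
          * mul_eval_polyA_add_eval_neg α z x
        + 2 * ((evenRem z).eval x + z (genA (Fin.last _)) * (polyB z).eval x)
          * eval_polyA_sub_eval_neg α z y
        - ((polyA α z).eval x - (polyA α z).eval (-x)) * mul_eval_polyA_add_eval_neg α z y
        - 2 * ((evenRem z).eval y + z (genA (Fin.last _)) * (polyB z).eval y)
          * eval_polyA_sub_eval_neg α z x)
      + 2 * η * (k : ℕ) * (polyB z).eval x * (x ^ 2 - y ^ 2)
        * (α * mul_eval_polyA_add_eval_neg α z y
          - z (genA (Fin.last _)) * eval_polyA_sub_eval_neg α z y)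
      - 4 * η * (polyB z).eval x * (α * (evenRem z).eval y
          - z (genA (Fin.last _)) * (oddRem α z).eval y) * pow_two_mul_sub_pow_two_mul k x y

lemma evalEval_brCC_eq_rem (α η : ℂ) (k : Fin 2) (z : Phase n) (x y : ℂ) :
    (brCC α η k z).evalEval x y =
      4 * η * (k : ℕ) * ((α * (evenRem z).eval x
            - z (genA (Fin.last _)) * (oddRem α z).eval x) * (polyC z).eval y
        - (polyC z).eval x * (α * (evenRem z).eval y
            - z (genA (Fin.last _)) * (oddRem α z).eval y)) := by
  rw [evalEval_brCC]
  simp only [eval_rho]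
  linear_combination
    -2 * η * (k : ℕ) * (polyC z).eval x * (α * mul_eval_polyA_add_eval_neg α z y
        - z (genA (Fin.last _)) * eval_polyA_sub_eval_neg α z y)
      + 2 * η * (k : ℕ) * (polyC z).eval y * (α * mul_eval_polyA_add_eval_neg α z x
        - z (genA (Fin.last _)) * eval_polyA_sub_eval_neg α z x)

/-- The exponents of an odd polynomial of degree less than `2 m`. -/
def oddExp (m : ℕ) (i : Fin m) : ℕ := 2 * i + 1

lemma oddExp_injective (m : ℕ) : Function.Injective (oddExp m) := fun i j h => by
  simpa [oddExp, Fin.val_inj] using h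

lemma supportedOn_oddExp_le_succ (m : ℕ) :
    supportedOn ℂ (oddExp m) ≤ supportedOn ℂ (oddExp (m + 1)) := fun _ hp j hj =>
  hp j fun ⟨i, hi⟩ => hj ⟨i.castSucc, hi⟩

lemma X_pow_mul_mem_supportedOn_oddExp {m : ℕ} (k : Fin 2) {p : ℂ[X]}
    (hp : p ∈ supportedOn ℂ (oddExp m)) :
    X ^ (2 * (k : ℕ)) * p ∈ supportedOn ℂ (oddExp (m + 1)) :=
  X_pow_mul_mem_supportedOn (fun i => ⟨⟨i + k, by lia⟩, by simp only [oddExp]; lia⟩) hp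

lemma X_pow_mul_mem_supportedOn_val {m j d : ℕ} (h : 2 * m + j ≤ d) {p : ℂ[X]}
    (hp : p ∈ supportedOn ℂ (oddExp m)) : X ^ j * p ∈ supportedOn ℂ (Fin.val : Fin d → ℕ) :=
  X_pow_mul_mem_supportedOn (fun i => ⟨⟨oddExp m i + j, by simp only [oddExp]; lia⟩, rfl⟩) hp

lemma mem_range_oddExp_of_add (m j l : ℕ) (h : j + 2 * l + 2 ∈ Set.range (oddExp (m + 1))) :
    j ∈ Set.range (oddExp m) := by
  obtain ⟨i, hi⟩ := h
  simp only [oddExp] at hi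
  exact ⟨⟨i - l - 1, by lia⟩, by simp only [oddExp]; lia⟩

lemma mem_range_val_of_add (m j l : ℕ)
    (h : j + 2 * l + 2 ∈ Set.range (Fin.val : Fin (m + 2) → ℕ)) :
    j ∈ Set.range (Fin.val : Fin m → ℕ) := by
  obtain ⟨i, hi⟩ := h
  exact ⟨⟨j, by lia⟩, rfl⟩

lemma polyC_mem_supportedOn (z : Phase n) : polyC z ∈ supportedOn ℂ (oddExp n) :=
  sum_C_mul_X_pow_mem_supportedOn (oddExp n) _

lemma oddRem_mem_supportedOn (α : ℂ) (z : Phase n) : oddRem α z ∈ supportedOn ℂ (oddExp n) :=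
  sum_C_mul_X_pow_mem_supportedOn (oddExp n) _

lemma evenRem_mem_supportedOn (z : Phase n) : evenRem z ∈ supportedOn ℂ (oddExp n) :=
  sum_C_mul_X_pow_mem_supportedOn (oddExp n) _

lemma polyB_mem_supportedOn (z : Phase n) : polyB z ∈ supportedOn ℂ (oddExp (n + 1)) := by
  refine add_mem (fun j hj => ?_) <|
    supportedOn_oddExp_le_succ n (sum_C_mul_X_pow_mem_supportedOn (oddExp n) _)
  rw [coeff_X_pow, if_neg fun h => hj ⟨Fin.last n, h.symm⟩]

/-- Half of `ρ_1(λ) A(-λ) - ρ_1(-λ) A(λ)`, where the multiples of `B(λ)` cancel. -/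
def crossRem (α : ℂ) (z : Phase n) : ℂ[X] :=
  α • evenRem z - z (genA (Fin.last (2 * n))) • oddRem α z

lemma crossRem_mem_supportedOn (α : ℂ) (z : Phase n) :
    crossRem α z ∈ supportedOn ℂ (oddExp n) :=
  sub_mem (Submodule.smul_mem _ _ (evenRem_mem_supportedOn z))
    (Submodule.smul_mem _ _ (oddRem_mem_supportedOn α z))

/-- The differential of the function `z ↦ A(x)`. -/
def dA (x : ℂ) : Phase n →L[ℂ] ℂ :=
  ∑ i : Fin (2 * n + 1), x ^ (i : ℕ) • ContinuousLinearMap.proj (genA i)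

/-- The differential of the function `z ↦ B(x)`. -/
def dB (x : ℂ) : Phase n →L[ℂ] ℂ :=
  ∑ i : Fin n, x ^ oddExp n i • ContinuousLinearMap.proj (genB i)

/-- The differential of the function `z ↦ C(x)`. -/
def dC (x : ℂ) : Phase n →L[ℂ] ℂ :=
  ∑ i : Fin n, x ^ oddExp n i • ContinuousLinearMap.proj (genC i)

/-- The bilinear form on covectors at `z` underlying the bracket `{·,·}_k`, which is its value on
the differentials of the two functions. -/
def poisson (α η : ℂ) (k : Fin 2) (z : Phase n) : LinearMap.BilinForm ℂ (Phase n →L[ℂ] ℂ) :=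
  LinearMap.mk₂ ℂ
    (fun u v => ∑ a, ∑ b, tensor α η k z a b * u (Pi.single a 1) * v (Pi.single b 1))
    (fun _ _ _ => by
      simp only [add_apply, mul_add, add_mul, Finset.sum_add_distrib])
    (fun _ _ _ => by
      simp only [smul_apply, smul_eq_mul, Finset.mul_sum]
      exact Finset.sum_congr rfl fun _ _ => Finset.sum_congr rfl fun _ _ => by ring)
    (fun _ _ _ => by
      simp only [add_apply, mul_add, Finset.sum_add_distrib])
    (fun _ _ _ => by
      simp only [smul_apply, smul_eq_mul, Finset.mul_sum]
      exact Finset.sum_congr rfl fun _ _ => Finset.sum_congr rfl fun _ _ => by ring)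

lemma bracket_eq_poisson (α η : ℂ) (k : Fin 2) (f g : Phase n → ℂ) (z : Phase n) :
    bracket α η k f g z = poisson α η k z (fderiv ℂ f z) (fderiv ℂ g z) := rfl

lemma poisson_proj_proj (α η : ℂ) (k : Fin 2) (z : Phase n) (a b : Gen n) :
    poisson α η k z (ContinuousLinearMap.proj a) (ContinuousLinearMap.proj b) =
      tensor α η k z a b := by
  simp [poisson, Pi.single_apply, -Fintype.sum_sum_type]

section Generators

variable (α η : ℂ) (k : Fin 2) (z : Phase n) (x y : ℂ)

lemma poisson_sum_sum {ι κ : Type*} [Fintype ι] [Fintype κ] (f : ι → ℕ) (g : κ → ℕ)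
    (a : ι → Gen n) (b : κ → Gen n) :
    poisson α η k z (∑ i, x ^ f i • ContinuousLinearMap.proj (a i))
        (∑ j, y ^ g j • ContinuousLinearMap.proj (b j)) =
      ∑ i, ∑ j, tensor α η k z (a i) (b j) * x ^ f i * y ^ g j := by
  simp only [map_sum, map_smul, LinearMap.sum_apply, LinearMap.smul_apply, poisson_proj_proj,
    smul_eq_mul, Finset.mul_sum]
  rw [Finset.sum_comm]
  exact Finset.sum_congr rfl fun i _ => Finset.sum_congr rfl fun j _ => by ring

lemma poisson_dA_dA : poisson α η k z (dA x) (dA y) = (brAA η k z).evalEval x y := by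
  have hB : ∀ j ≤ 1, X ^ j * polyB z ∈ supportedOn ℂ (Fin.val : Fin (2 * n + 3) → ℕ) := fun j _ =>
    X_pow_mul_mem_supportedOn_val (by lia) (polyB_mem_supportedOn z)
  have hC : ∀ j ≤ 1, X ^ (2 * (k : ℕ) + j) * polyC z ∈
      supportedOn ℂ (Fin.val : Fin (2 * n + 3) → ℕ) := fun j _ =>
    X_pow_mul_mem_supportedOn_val (by lia) (polyC_mem_supportedOn z)
  refine (poisson_sum_sum α η k z x y _ _ _ _).trans
    (evalEval_eq_sum_of_mul_sq_sub_sq Fin.val_injective Fin.val_injective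
      (mem_range_val_of_add (2 * n + 1)) (mem_range_val_of_add (2 * n + 1)) (c := η)
      (p := ![X ^ 1 * polyB z, -(X ^ 0 * polyB z),
        -(X ^ (2 * (k : ℕ) + 1) * polyC z), X ^ (2 * (k : ℕ) + 0) * polyC z])
      (q := ![X ^ (2 * (k : ℕ) + 0) * polyC z, X ^ (2 * (k : ℕ) + 1) * polyC z,
        X ^ 0 * polyB z, X ^ 1 * polyB z]) (fun i => ?_) (fun i => ?_) (fun x y => ?_) x y).symm
  · fin_cases i
    exacts [hB 1 le_rfl, neg_mem (hB 0 zero_le_one), neg_mem (hC 1 le_rfl), hC 0 zero_le_one]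
  · fin_cases i
    exacts [hC 0 zero_le_one, hC 1 le_rfl, hB 0 zero_le_one, hB 1 le_rfl]
  · simp only [Fin.sum_univ_four, Matrix.cons_val, eval_mul, eval_pow, eval_X, eval_neg]
    linear_combination (x - y) * evalEval_brAA_mul η k z x y

lemma poisson_dA_dB : poisson α η k z (dA x) (dB y) = (brAB α η k z).evalEval x y := by
  refine (poisson_sum_sum α η k z x y _ _ _ _).trans
    (evalEval_eq_sum_of_mul_sq_sub_sq Fin.val_injective (oddExp_injective n)
      (mem_range_val_of_add (2 * n + 1)) (mem_range_oddExp_of_add n) (c := 2 * η)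
      (p := ![X ^ (2 * (k : ℕ)) * evenRem z + X ^ (2 * (k : ℕ) + 1) * oddRem α z,
        -(X ^ 0 * polyB z), -(X ^ 1 * polyB z)])
      (q := ![polyB z, X ^ (2 * (k : ℕ)) * evenRem z, X ^ (2 * (k : ℕ)) * oddRem α z])
      (fun i => ?_) (fun i => ?_) (fun x y => ?_) x y).symm
  · fin_cases i
    exacts [add_mem (X_pow_mul_mem_supportedOn_val (by lia) (evenRem_mem_supportedOn z))
        (X_pow_mul_mem_supportedOn_val (by lia) (oddRem_mem_supportedOn α z)),
      neg_mem (X_pow_mul_mem_supportedOn_val (by lia) (polyB_mem_supportedOn z)),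
      neg_mem (X_pow_mul_mem_supportedOn_val (by lia) (polyB_mem_supportedOn z))]
  · fin_cases i
    exacts [polyB_mem_supportedOn z,
      X_pow_mul_mem_supportedOn_oddExp k (evenRem_mem_supportedOn z),
      X_pow_mul_mem_supportedOn_oddExp k (oddRem_mem_supportedOn α z)]
  · simp only [Fin.sum_univ_three, Matrix.cons_val, eval_add, eval_mul, eval_pow, eval_X, eval_neg]
    linear_combination evalEval_brAB_mul_eq_rem α η k z x y

lemma poisson_dA_dC : poisson α η k z (dA x) (dC y) = (brAC α η k z).evalEval x y := by
  refine (poisson_sum_sum α η k z x y _ _ _ _).trans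
    (evalEval_eq_sum_of_mul_sq_sub_sq Fin.val_injective (oddExp_injective n)
      (mem_range_val_of_add (2 * n + 1)) (mem_range_oddExp_of_add n) (c := -2 * η)
      (p := ![X ^ (2 * (k : ℕ)) * evenRem z + X ^ (2 * (k : ℕ) + 1) * oddRem α z,
        α • (X ^ 1 * polyB z) + z (genA (Fin.last _)) • (X ^ 0 * polyB z),
        -(X ^ (2 * (k : ℕ)) * polyC z), -(X ^ (2 * (k : ℕ) + 1) * polyC z)])
      (q := ![polyC z, X ^ (2 * (k : ℕ)) * polyC z,
        evenRem z + z (genA (Fin.last _)) • polyB z, oddRem α z + α • polyB z])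
      (fun i => ?_) (fun i => ?_) (fun x y => ?_) x y).symm
  · fin_cases i
    exacts [add_mem (X_pow_mul_mem_supportedOn_val (by lia) (evenRem_mem_supportedOn z))
        (X_pow_mul_mem_supportedOn_val (by lia) (oddRem_mem_supportedOn α z)),
      add_mem
        (Submodule.smul_mem _ _
          (X_pow_mul_mem_supportedOn_val (by lia) (polyB_mem_supportedOn z)))
        (Submodule.smul_mem _ _
          (X_pow_mul_mem_supportedOn_val (by lia) (polyB_mem_supportedOn z))),
      neg_mem (X_pow_mul_mem_supportedOn_val (by lia) (polyC_mem_supportedOn z)),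
      neg_mem (X_pow_mul_mem_supportedOn_val (by lia) (polyC_mem_supportedOn z))]
  · fin_cases i
    exacts [supportedOn_oddExp_le_succ n (polyC_mem_supportedOn z),
      X_pow_mul_mem_supportedOn_oddExp k (polyC_mem_supportedOn z),
      add_mem (supportedOn_oddExp_le_succ n (evenRem_mem_supportedOn z))
        (Submodule.smul_mem _ _ (polyB_mem_supportedOn z)),
      add_mem (supportedOn_oddExp_le_succ n (oddRem_mem_supportedOn α z))
        (Submodule.smul_mem _ _ (polyB_mem_supportedOn z))]
  · simp only [Fin.sum_univ_four, Matrix.cons_val, eval_add, eval_mul, eval_pow, eval_X, eval_neg,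
      eval_smul, smul_eq_mul]
    linear_combination evalEval_brAC_mul_eq_rem α η k z x y

lemma poisson_dB_dC : poisson α η k z (dB x) (dC y) = (brBC α η k z).evalEval x y := by
  have hrem {p : ℂ[X]} (hp : p ∈ supportedOn ℂ (oddExp n)) := X_pow_mul_mem_supportedOn_oddExp k hp
  refine (poisson_sum_sum α η k z x y _ _ _ _).trans
    (evalEval_eq_sum_of_mul_sq_sub_sq (oddExp_injective n) (oddExp_injective n)
      (mem_range_oddExp_of_add n) (mem_range_oddExp_of_add n) (c := 4 * η)
      (p := ![X ^ (2 * (k : ℕ)) * evenRem z, -(X ^ (2 * (k : ℕ)) * oddRem α z),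
        X ^ (2 * (k : ℕ)) * crossRem α z, -polyB z])
      (q := ![oddRem α z, evenRem z, polyB z, X ^ (2 * (k : ℕ)) * crossRem α z])
      (fun i => ?_) (fun i => ?_) (fun x y => ?_) x y).symm
  · fin_cases i
    exacts [hrem (evenRem_mem_supportedOn z), neg_mem (hrem (oddRem_mem_supportedOn α z)),
      hrem (crossRem_mem_supportedOn α z), neg_mem (polyB_mem_supportedOn z)]
  · fin_cases i
    exacts [supportedOn_oddExp_le_succ n (oddRem_mem_supportedOn α z),
      supportedOn_oddExp_le_succ n (evenRem_mem_supportedOn z), polyB_mem_supportedOn z,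
      hrem (crossRem_mem_supportedOn α z)]
  · simp only [Fin.sum_univ_four, Matrix.cons_val, crossRem, eval_mul, eval_pow, eval_X, eval_neg,
      eval_sub, eval_smul, smul_eq_mul]
    linear_combination evalEval_brBC_mul_eq_rem α η k z x y

lemma poisson_dC_dC : poisson α η k z (dC x) (dC y) = (brCC α η k z).evalEval x y := by
  have hrem {p : ℂ[X]} (hp : p ∈ supportedOn ℂ (oddExp n)) := X_pow_mul_mem_supportedOn_oddExp 1 hp
  have hC := supportedOn_oddExp_le_succ n (polyC_mem_supportedOn z)
  have hcross := supportedOn_oddExp_le_succ n (crossRem_mem_supportedOn α z)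
  refine (poisson_sum_sum α η k z x y _ _ _ _).trans
    (evalEval_eq_sum_of_mul_sq_sub_sq (oddExp_injective n) (oddExp_injective n)
      (mem_range_oddExp_of_add n) (mem_range_oddExp_of_add n) (c := 4 * η * (k : ℕ))
      (p := ![X ^ (2 * ((1 : Fin 2) : ℕ)) * crossRem α z, -crossRem α z,
        -(X ^ (2 * ((1 : Fin 2) : ℕ)) * polyC z), polyC z])
      (q := ![polyC z, X ^ (2 * ((1 : Fin 2) : ℕ)) * polyC z, crossRem α z,
        X ^ (2 * ((1 : Fin 2) : ℕ)) * crossRem α z])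
      (fun i => ?_) (fun i => ?_) (fun x y => ?_) x y).symm
  · fin_cases i
    exacts [hrem (crossRem_mem_supportedOn α z), neg_mem hcross,
      neg_mem (hrem (polyC_mem_supportedOn z)), hC]
  · fin_cases i
    exacts [hC, hrem (polyC_mem_supportedOn z), hcross, hrem (crossRem_mem_supportedOn α z)]
  · simp only [Fin.sum_univ_four, Matrix.cons_val, crossRem, eval_mul, eval_pow, eval_X, eval_neg,
      eval_sub, eval_smul, smul_eq_mul, Fin.val_one]
    linear_combination (x ^ 2 - y ^ 2) * evalEval_brCC_eq_rem α η k z x y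

lemma poisson_dB_dB : poisson α η k z (dB x) (dB y) = 0 := by
  simp only [dB, poisson_sum_sum, tensor, zero_mul, Finset.sum_const_zero]

lemma poisson_dB_dA : poisson α η k z (dB x) (dA y) = -poisson α η k z (dA y) (dB x) := by
  simp only [dA, dB, poisson_sum_sum, tensor, neg_mul, Finset.sum_neg_distrib, mul_right_comm]
  rw [Finset.sum_comm]

lemma poisson_dC_dA : poisson α η k z (dC x) (dA y) = -poisson α η k z (dA y) (dC x) := by
  simp only [dA, dC, poisson_sum_sum, tensor, neg_mul, Finset.sum_neg_distrib, mul_right_comm]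
  rw [Finset.sum_comm]

lemma poisson_dC_dB : poisson α η k z (dC x) (dB y) = -poisson α η k z (dB y) (dC x) := by
  simp only [dB, dC, poisson_sum_sum, tensor, neg_mul, Finset.sum_neg_distrib,
    mul_right_comm _ (x ^ _)]
  rw [Finset.sum_comm]

end Generators

section AnalyticFamily

variable {𝕜 E : Type*} [NontriviallyNormedField 𝕜] [NormedAddCommGroup E] [NormedSpace 𝕜 E]

/-- A family of polynomials of bounded degree whose coefficients depend analytically on a parameter
in `U`; for example `z ↦ T(λ)_{ij}` and `z ↦ τ(λ)`. -/
def IsAnalyticFamily (F : E → 𝕜[X]) (U : Set E) : Prop :=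
  (∃ L, ∀ z, (F z).natDegree < L) ∧ ∀ l, AnalyticOnNhd 𝕜 (fun z => (F z).coeff l) U

namespace IsAnalyticFamily

variable {F G : E → 𝕜[X]} {U V : Set E}

lemma const (p : 𝕜[X]) (U : Set E) : IsAnalyticFamily (fun _ => p) U :=
  ⟨⟨_, fun _ => Nat.lt_succ_self _⟩, fun _ => analyticOnNhd_const⟩

lemma C_comp {f : E → 𝕜} (hf : AnalyticOnNhd 𝕜 f U) : IsAnalyticFamily (fun z => C (f z)) U := by
  refine ⟨⟨1, fun z => by simp only [natDegree_C, zero_lt_one]⟩, fun l => ?_⟩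
  simp only [coeff_C]
  split_ifs
  exacts [hf, analyticOnNhd_const]

lemma mono (hF : IsAnalyticFamily F U) (hV : V ⊆ U) : IsAnalyticFamily F V :=
  ⟨hF.1, fun l => (hF.2 l).mono hV⟩

lemma add (hF : IsAnalyticFamily F U) (hG : IsAnalyticFamily G U) :
    IsAnalyticFamily (fun z => F z + G z) U := by
  obtain ⟨⟨L, hL⟩, hF⟩ := hF
  obtain ⟨⟨M, hM⟩, hG⟩ := hG
  refine ⟨⟨max L M, fun z => (natDegree_add_le _ _).trans_lt (max_lt_max (hL z) (hM z))⟩,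
    fun l => ?_⟩
  simp only [coeff_add]
  exact (hF l).add (hG l)

lemma mul (hF : IsAnalyticFamily F U) (hG : IsAnalyticFamily G U) :
    IsAnalyticFamily (fun z => F z * G z) U := by
  obtain ⟨⟨L, hL⟩, hF⟩ := hF
  obtain ⟨⟨M, hM⟩, hG⟩ := hG
  refine ⟨⟨L + M, fun z => natDegree_mul_le.trans_lt (add_lt_add (hL z) (hM z))⟩, fun l => ?_⟩
  simp only [coeff_mul]
  exact Finset.analyticOnNhd_fun_sum _ fun i _ => (hF _).mul (hG _)

lemma sub (hF : IsAnalyticFamily F U) (hG : IsAnalyticFamily G U) :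
    IsAnalyticFamily (fun z => F z - G z) U := by
  simpa only [sub_eq_add_neg, neg_one_mul] using hF.add ((const (-1) U).mul hG)

lemma sum {ι : Type*} {s : Finset ι} {F : ι → E → 𝕜[X]}
    (hF : ∀ i ∈ s, IsAnalyticFamily (F i) U) : IsAnalyticFamily (fun z => ∑ i ∈ s, F i z) U := by
  classical
  induction s using Finset.induction_on with
  | empty => simpa only [Finset.sum_empty] using const 0 U
  | insert i s hi ih =>
    simp only [Finset.sum_insert hi]
    exact (hF i (s.mem_insert_self i)).add (ih fun j hj => hF j (Finset.mem_insert_of_mem hj))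

lemma comp_neg_X (hF : IsAnalyticFamily F U) : IsAnalyticFamily (fun z => (F z).comp (-X)) U := by
  obtain ⟨⟨L, hL⟩, hF⟩ := hF
  refine ⟨⟨L, fun z => ?_⟩, fun l => ?_⟩
  · rw [natDegree_comp, natDegree_neg, natDegree_X, mul_one]
    exact hL z
  · simp only [← neg_one_mul (X : 𝕜[X]), ← C_1, ← C_neg, comp_C_mul_X_coeff]
    exact (hF l).mul analyticOnNhd_const

lemma derivative (hF : IsAnalyticFamily F U) :
    IsAnalyticFamily (fun z => Polynomial.derivative (F z)) U := by
  obtain ⟨⟨L, hL⟩, hF⟩ := hF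
  refine ⟨⟨L, fun z => (natDegree_derivative_le _).trans_lt ((Nat.sub_le _ _).trans_lt (hL z))⟩,
    fun l => ?_⟩
  simp only [coeff_derivative]
  exact (hF _).mul analyticOnNhd_const

end IsAnalyticFamily

lemma hasFDerivAt_eval_comp {F : E → 𝕜[X]} {z : E} {L : ℕ} (hL : ∀ z, (F z).natDegree < L)
    (hF : ∀ l, DifferentiableAt 𝕜 (fun z => (F z).coeff l) z) {ρ : E → 𝕜} {ρ' : E →L[𝕜] 𝕜}
    (hρ : HasFDerivAt ρ ρ' z) :
    HasFDerivAt (fun w => (F w).eval (ρ w))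
      (∑ l : Fin L, ρ z ^ (l : ℕ) • fderiv 𝕜 (fun w => (F w).coeff l) z
        + (Polynomial.derivative (F z)).eval (ρ z) • ρ') z := by
  have hterm (l : Fin L) := (hF l).hasFDerivAt.mul (hρ.pow l)
  have hsum := HasFDerivAt.fun_sum (u := Finset.univ) fun l _ => hterm l
  have heval (w : E) : (F w).eval (ρ w) = ∑ l : Fin L, (F w).coeff l * ρ w ^ (l : ℕ) := by
    rw [eval_eq_sum_range' (hL w), Fin.sum_univ_eq_sum_range fun l => (F w).coeff l * ρ w ^ l]
  have hderiv : (Polynomial.derivative (F z)).eval (ρ z) =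
      ∑ l : Fin L, (F z).coeff l * ((l : ℕ) * ρ z ^ ((l : ℕ) - 1)) := by
    rw [derivative_eval, sum_over_range' _ (fun l => by rw [zero_mul, zero_mul]) L (hL z),
      Fin.sum_univ_eq_sum_range fun l => (F z).coeff l * ((l : 𝕜) * ρ z ^ (l - 1))]
    simp only [mul_assoc]
  simp only [heval, hderiv]
  refine hsum.congr_fderiv ?_
  ext v
  simp only [add_apply, smul_apply, sum_apply, smul_eq_mul, nsmul_eq_mul,
    Finset.sum_add_distrib, Finset.sum_mul, mul_assoc]
  rw [add_comm]

lemma hasFDerivAt_eval {F : E → 𝕜[X]} {z : E} {L : ℕ} (hL : ∀ z, (F z).natDegree < L)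
    (hF : ∀ l, DifferentiableAt 𝕜 (fun z => (F z).coeff l) z) (x : 𝕜) :
    HasFDerivAt (fun w => (F w).eval x)
      (∑ l : Fin L, x ^ (l : ℕ) • fderiv 𝕜 (fun w => (F w).coeff l) z) z := by
  refine (hasFDerivAt_eval_comp hL hF (hasFDerivAt_const x z)).congr_fderiv ?_
  ext v
  simp only [add_apply, smul_apply, zero_apply, smul_zero, add_zero]

/-- The span, at a point, of the differentials of the coefficients of a family of polynomials. -/
def coeffSpan (F : E → 𝕜[X]) (z : E) : Submodule 𝕜 (E →L[𝕜] 𝕜) :=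
  .span 𝕜 (Set.range fun l => fderiv 𝕜 (fun w => (F w).coeff l) z)

lemma fderiv_coeff_mem_coeffSpan (F : E → 𝕜[X]) (l : ℕ) (z : E) :
    fderiv 𝕜 (fun w => (F w).coeff l) z ∈ coeffSpan F z :=
  Submodule.subset_span ⟨l, rfl⟩

namespace IsAnalyticFamily

variable {F : E → 𝕜[X]} {U : Set E} {z : E}

lemma differentiableAt_eval (hF : IsAnalyticFamily F U) (hz : z ∈ U) (x : 𝕜) :
    DifferentiableAt 𝕜 (fun w => (F w).eval x) z :=
  have ⟨_, hL⟩ := hF.1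
  (hasFDerivAt_eval hL (fun l => (hF.2 l z hz).differentiableAt) x).differentiableAt

lemma fderiv_eval_mem_coeffSpan (hF : IsAnalyticFamily F U) (hz : z ∈ U) (x : 𝕜) :
    fderiv 𝕜 (fun w => (F w).eval x) z ∈ coeffSpan F z := by
  obtain ⟨L, hL⟩ := hF.1
  rw [(hasFDerivAt_eval hL (fun l => (hF.2 l z hz).differentiableAt) x).fderiv]
  exact sum_mem fun l _ => Submodule.smul_mem _ _ (fderiv_coeff_mem_coeffSpan F l z)

lemma coeffSpan_le (hF : IsAnalyticFamily F U) (hz : z ∈ U) {p : Submodule 𝕜 (E →L[𝕜] 𝕜)}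
    (h : ∀ x, fderiv 𝕜 (fun w => (F w).eval x) z ∈ p) : coeffSpan F z ≤ p := by
  have : Infinite 𝕜 := NontriviallyNormedField.infinite 𝕜
  obtain ⟨L, hL⟩ := hF.1
  rw [coeffSpan, Submodule.span_le, Set.range_subset_iff]
  intro l
  by_cases hl : l < L
  · refine mem_of_forall_sum_pow_smul_mem
      (v := fun l : Fin L => fderiv 𝕜 (fun w => (F w).coeff l) z)
      Fin.val_injective Set.infinite_univ (fun x _ => ?_) ⟨l, hl⟩
    rw [← (hasFDerivAt_eval hL (fun l => (hF.2 l z hz).differentiableAt) x).fderiv]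
    exact h x
  · simp only [coeff_eq_zero_of_natDegree_lt ((hL _).trans_le (not_lt.1 hl)), fderiv_fun_const]
    exact p.zero_mem

lemma hasFDerivAt_eval_comp (hF : IsAnalyticFamily F U) (hz : z ∈ U) {ρ : E → 𝕜} {ρ' : E →L[𝕜] 𝕜}
    (hρ : HasFDerivAt ρ ρ' z) : HasFDerivAt (fun w => (F w).eval (ρ w))
      (fderiv 𝕜 (fun w => (F w).eval (ρ z)) z + (Polynomial.derivative (F z)).eval (ρ z) • ρ')
      z := by
  obtain ⟨L, hL⟩ := hF.1
  have hcoeff (l : ℕ) := (hF.2 l z hz).differentiableAt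
  rw [(hasFDerivAt_eval hL hcoeff (ρ z)).fderiv]
  exact ReflectionAlgebra.hasFDerivAt_eval_comp hL hcoeff hρ

end IsAnalyticFamily

end AnalyticFamily

lemma analyticOnNhd_apply (a : Gen n) (U : Set (Phase n)) :
    AnalyticOnNhd ℂ (fun z : Phase n => z a) U :=
  (ContinuousLinearMap.proj (R := ℂ) (φ := fun _ : Gen n => ℂ) a).analyticOnNhd U

variable (U : Set (Phase n))

lemma isAnalyticFamily_polyA (α : ℂ) : IsAnalyticFamily (polyA (n := n) α) U :=
  (IsAnalyticFamily.const _ U).add <| .sum fun _ _ =>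
    (IsAnalyticFamily.C_comp (analyticOnNhd_apply _ U)).mul (.const _ U)

lemma isAnalyticFamily_polyB : IsAnalyticFamily (polyB (n := n)) U :=
  (IsAnalyticFamily.const _ U).add <| .sum fun _ _ =>
    (IsAnalyticFamily.C_comp (analyticOnNhd_apply _ U)).mul (.const _ U)

lemma isAnalyticFamily_polyC : IsAnalyticFamily (polyC (n := n)) U :=
  .sum fun _ _ => (IsAnalyticFamily.C_comp (analyticOnNhd_apply _ U)).mul (.const _ U)

lemma isAnalyticFamily_det_matT (α : ℂ) :
    IsAnalyticFamily (fun z : Phase n => (matT α z).det) U := by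
  simp only [matT, Matrix.det_fin_two_of]
  exact ((isAnalyticFamily_polyA U α).mul (isAnalyticFamily_polyA U α).comp_neg_X).sub
    ((isAnalyticFamily_polyB U).mul (isAnalyticFamily_polyC U))

lemma hasFDerivAt_eval_polyA (α : ℂ) (x : ℂ) (z : Phase n) :
    HasFDerivAt (fun z : Phase n => (polyA α z).eval x) (dA x) z := by
  have hA (z : Phase n) : (polyA α z).eval x = α * x ^ (2 * n + 1) + dA x z := by
    simp only [polyA, dA, eval_add, eval_mul, eval_C, eval_pow, eval_X, eval_finsetSum,
      sum_apply, smul_apply, ContinuousLinearMap.proj_apply, smul_eq_mul,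
      mul_comm (z _)]
  simp only [hA]
  exact (dA x).hasFDerivAt.const_add _

lemma hasFDerivAt_eval_polyB (x : ℂ) (z : Phase n) :
    HasFDerivAt (fun z : Phase n => (polyB z).eval x) (dB x) z := by
  have hB (z : Phase n) : (polyB z).eval x = x ^ (2 * n + 1) + dB x z := by
    simp only [polyB, dB, oddExp, eval_add, eval_mul, eval_C, eval_pow, eval_X, eval_finsetSum,
      sum_apply, smul_apply, ContinuousLinearMap.proj_apply, smul_eq_mul,
      mul_comm (z _)]
  simp only [hB]
  exact (dB x).hasFDerivAt.const_add _

lemma hasFDerivAt_eval_polyC (x : ℂ) (z : Phase n) :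
    HasFDerivAt (fun z : Phase n => (polyC z).eval x) (dC x) z := by
  have hC (z : Phase n) : (polyC z).eval x = dC x z := by
    simp only [polyC, dC, oddExp, eval_mul, eval_C, eval_pow, eval_X, eval_finsetSum,
      sum_apply, smul_apply, ContinuousLinearMap.proj_apply, smul_eq_mul,
      mul_comm (z _)]
  simp only [hC]
  exact (dC x).hasFDerivAt

/-- The differential of the function `z ↦ det T(x)`. -/
def dDet (α : ℂ) (z : Phase n) (x : ℂ) : Phase n →L[ℂ] ℂ :=
  (polyA α z).eval (-x) • dA x + (polyA α z).eval x • dA (-x)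
    - ((polyC z).eval x • dB x + (polyB z).eval x • dC x)

lemma hasFDerivAt_eval_det_matT (α : ℂ) (x : ℂ) (z : Phase n) :
    HasFDerivAt (fun z : Phase n => (matT α z).det.eval x) (dDet α z x) z := by
  simp only [matT, Matrix.det_fin_two_of, eval_sub, eval_mul, eval_comp, eval_neg, eval_X]
  refine (((hasFDerivAt_eval_polyA α x z).fun_mul (hasFDerivAt_eval_polyA α (-x) z)).fun_sub
    ((hasFDerivAt_eval_polyB x z).fun_mul (hasFDerivAt_eval_polyC x z))).congr_fderiv ?_
  rw [dDet, add_comm (_ • dA (-x)), add_comm (_ • dC x)]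

lemma dDet_mem_casimirSpan (α : ℂ) (z : Phase n) (x : ℂ) : dDet α z x ∈ casimirSpan α z := by
  rw [← (hasFDerivAt_eval_det_matT α x z).fderiv]
  exact (isAnalyticFamily_det_matT Set.univ α).fderiv_eval_mem_coeffSpan (Set.mem_univ z) x

lemma casimirSpan_le {α : ℂ} {z : Phase n} {p : Submodule ℂ (Phase n →L[ℂ] ℂ)}
    (h : ∀ x, dDet α z x ∈ p) : casimirSpan α z ≤ p :=
  (isAnalyticFamily_det_matT Set.univ α).coeffSpan_le (Set.mem_univ z) fun x =>
    (hasFDerivAt_eval_det_matT α x z).fderiv ▸ h x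

/-- The differentials of the functions `z ↦ A(x)`, `z ↦ B(x)` and `z ↦ C(x)`. -/
def generators (x : ℂ) : Set (Phase n →L[ℂ] ℂ) := {dA x, dB x, dC x}

lemma eq_top_of_generators_mem {p : Submodule ℂ (Phase n →L[ℂ] ℂ)} (c : ℂ)
    (h : ∀ x, x ^ 2 ≠ c ^ 2 → ∀ u ∈ generators (n := n) x, u ∈ p) : p = ⊤ := by
  have hinf : {x : ℂ | x ^ 2 ≠ c ^ 2}.Infinite := by
    refine (Set.toFinite {c, -c}).infinite_compl.mono ?_
    exact fun x hx hsq => hx (sq_eq_sq_iff_eq_or_eq_neg.1 hsq)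
  have hproj (a : Gen n) : ContinuousLinearMap.proj a ∈ p := by
    rcases a with i | i | i
    · exact mem_of_forall_sum_pow_smul_mem Fin.val_injective hinf
        (fun x hx => h x hx _ (.inl rfl)) i
    · exact mem_of_forall_sum_pow_smul_mem (oddExp_injective n) hinf
        (fun x hx => h x hx _ (.inr (.inl rfl))) i
    · exact mem_of_forall_sum_pow_smul_mem (oddExp_injective n) hinf
        (fun x hx => h x hx _ (.inr (.inr rfl))) i
  refine eq_top_iff.2 fun u _ => ?_
  have hu : u = ∑ a, u (Pi.single a 1) • ContinuousLinearMap.proj a := by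
    ext w
    conv_lhs => rw [pi_eq_sum_univ' w, map_sum]
    simp [-Fintype.sum_sum_type, mul_comm]
  rw [hu]
  exact sum_mem fun a _ => p.smul_mem _ (hproj a)

lemma add_ne_zero_of_sq_ne_sq {R : Type*} [CommRing R] {x y : R} (h : x ^ 2 ≠ y ^ 2) :
    x + y ≠ 0 := fun hadd => h (by linear_combination (x - y) * hadd)

lemma bilinForm_mem_of_generators {ι : Type*} {N : Submodule ℂ (ι → ℂ)}
    (Φ : ι → LinearMap.BilinForm ℂ (Phase n →L[ℂ] ℂ))
    (h : ∀ x y : ℂ, x ^ 2 ≠ y ^ 2 → ∀ u ∈ generators (n := n) x, ∀ v ∈ generators (n := n) y,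
      (fun i => Φ i u v) ∈ N) (u v : Phase n →L[ℂ] ℂ) : (fun i => Φ i u v) ∈ N := by
  have hgen (y : ℂ) (v) (hv : v ∈ generators (n := n) y) : (fun i => Φ i u v) ∈ N := by
    have htop : N.comap (LinearMap.pi fun i => (Φ i).flip v) = ⊤ :=
      eq_top_of_generators_mem y fun x hxy u hu => h x y hxy u hu v hv
    exact htop.ge (Submodule.mem_top (x := u))
  have htop : N.comap (LinearMap.pi fun i => Φ i u) = ⊤ :=
    eq_top_of_generators_mem 0 fun y _ => hgen y
  exact htop.ge (Submodule.mem_top (x := v))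

lemma isAlt_poisson (α η : ℂ) (k : Fin 2) (z : Phase n) : (poisson α η k z).IsAlt := by
  refine LinearMap.isAlt_iff_eq_neg_flip.2 ?_
  ext u v
  refine eq_neg_of_add_eq_zero_left (congrFun (bilinForm_mem_of_generators (N := ⊥)
    (fun _ : Unit => poisson α η k z + (poisson α η k z).flip) ?_ u v) ())
  intro x y hxy u hu v hv
  refine funext fun _ => ?_
  change poisson α η k z u v + poisson α η k z v u = 0
  rcases hu with rfl | rfl | rfl <;> rcases hv with rfl | rfl | rfl
  · rw [poisson_dA_dA, poisson_dA_dA]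
    refine mul_right_cancel₀ (add_ne_zero_of_sq_ne_sq hxy) ?_
    linear_combination evalEval_brAA_mul η k z x y + evalEval_brAA_mul η k z y x
  all_goals
    simp only [poisson_dB_dA, poisson_dC_dA, poisson_dC_dB, poisson_dB_dB, poisson_dC_dC,
      evalEval_brCC, add_neg_cancel, neg_add_cancel, add_zero]
  ring

lemma continuous_poisson (α η : ℂ) (k : Fin 2) (u v : Phase n →L[ℂ] ℂ) :
    Continuous fun z => poisson α η k z u v := by
  refine bilinForm_mem_of_generators (N := continuousSubmodule (Phase n) ℂ ℂ) (poisson α η k)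
    (fun x y hxy u hu v hv => ?_) u v
  change Continuous fun z => poisson α η k z u v
  have hA (x : ℂ) : Continuous fun z : Phase n => (polyA α z).eval x :=
    continuous_iff_continuousAt.2 fun z => (hasFDerivAt_eval_polyA α x z).continuousAt
  have hB (x : ℂ) : Continuous fun z : Phase n => (polyB z).eval x :=
    continuous_iff_continuousAt.2 fun z => (hasFDerivAt_eval_polyB x z).continuousAt
  have hC (x : ℂ) : Continuous fun z : Phase n => (polyC z).eval x :=
    continuous_iff_continuousAt.2 fun z => (hasFDerivAt_eval_polyC x z).continuousAt
  have hsub {x y : ℂ} (hxy : x ^ 2 ≠ y ^ 2) : x ^ 2 - y ^ 2 ≠ 0 := sub_ne_zero.2 hxy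
  rcases hu with rfl | rfl | rfl <;> rcases hv with rfl | rfl | rfl <;>
    simp only [poisson_dB_dA, poisson_dC_dA, poisson_dC_dB, poisson_dB_dB, poisson_dA_dA,
      poisson_dA_dB, poisson_dA_dC, poisson_dB_dC, poisson_dC_dC, evalEval_brCC, eval_rho,
      eq_div_of_mul_eq (add_ne_zero_of_sq_ne_sq hxy) (evalEval_brAA_mul η k _ x y),
      eq_div_of_mul_eq (hsub hxy) (evalEval_brAB_mul α η k _ x y),
      eq_div_of_mul_eq (hsub hxy) (evalEval_brAC_mul α η k _ x y),
      eq_div_of_mul_eq (hsub hxy) (evalEval_brBC_mul α η k _ x y),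
      eq_div_of_mul_eq (hsub hxy.symm) (evalEval_brAB_mul α η k _ y x),
      eq_div_of_mul_eq (hsub hxy.symm) (evalEval_brAC_mul α η k _ y x),
      eq_div_of_mul_eq (hsub hxy.symm) (evalEval_brBC_mul α η k _ y x)] <;>
    fun_prop

section Casimir

variable (α η : ℂ) (k : Fin 2) (z : Phase n) (x y : ℂ)

lemma poisson_dDet_dA_mul : poisson α η k z (dDet α z x) (dA y) * (x ^ 2 - y ^ 2) = 0 := by
  have hAA := evalEval_brAA_mul η k z x y
  have hAA_neg := evalEval_brAA_mul η k z (-x) y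
  have hAB := evalEval_brAB_mul α η k z y x
  have hAC := evalEval_brAC_mul α η k z y x
  simp only [dDet, map_sub, map_add, map_smul, LinearMap.sub_apply, LinearMap.add_apply,
    LinearMap.smul_apply, smul_eq_mul, poisson_dB_dA, poisson_dC_dA, poisson_dA_dA, poisson_dA_dB,
    poisson_dA_dC]
  rw [eval_polyB_neg, eval_polyC_neg] at hAA_neg
  rw [eval_rho] at hAB hAC
  obtain hk | hk : (k : ℕ) = 0 ∨ (k : ℕ) = 1 := by lia
  all_goals
    simp only [hk, Nat.cast_zero, Nat.cast_one] at hAA hAA_neg hAB hAC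
    linear_combination (polyA α z).eval (-x) * (x - y) * hAA
      - (polyA α z).eval x * (x + y) * hAA_neg - (polyC z).eval x * hAB - (polyB z).eval x * hAC

lemma poisson_dDet_dB_mul : poisson α η k z (dDet α z x) (dB y) * (x ^ 2 - y ^ 2) = 0 := by
  have hAB := evalEval_brAB_mul α η k z x y
  have hAB_neg := evalEval_brAB_mul α η k z (-x) y
  have hBC := evalEval_brBC_mul α η k z y x
  simp only [dDet, map_sub, map_add, map_smul, LinearMap.sub_apply, LinearMap.add_apply,
    LinearMap.smul_apply, smul_eq_mul, poisson_dB_dB, poisson_dC_dB, poisson_dA_dB, poisson_dB_dC]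
  rw [eval_polyB_neg, (even_two_mul _).neg_pow, neg_sq] at hAB_neg
  linear_combination (polyA α z).eval (-x) * hAB
    + (polyA α z).eval x * hAB_neg - (polyB z).eval x * hBC

lemma poisson_dDet_dC_mul : poisson α η k z (dDet α z x) (dC y) * (x ^ 2 - y ^ 2) = 0 := by
  have hAC := evalEval_brAC_mul α η k z x y
  have hAC_neg := evalEval_brAC_mul α η k z (-x) y
  have hBC := evalEval_brBC_mul α η k z x y
  have hCC := evalEval_brCC α η k z x y
  simp only [dDet, map_sub, map_add, map_smul, LinearMap.sub_apply, LinearMap.add_apply,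
    LinearMap.smul_apply, smul_eq_mul, poisson_dA_dC, poisson_dB_dC, poisson_dC_dC]
  rw [eval_polyB_neg, eval_polyC_neg, neg_sq] at hAC_neg
  simp only [eval_rho] at hAC hAC_neg hBC hCC
  obtain hk | hk : (k : ℕ) = 0 ∨ (k : ℕ) = 1 := by lia
  all_goals
    simp only [hk, Nat.cast_zero, Nat.cast_one] at hAC hAC_neg hBC hCC
    linear_combination (polyA α z).eval (-x) * hAC + (polyA α z).eval x * hAC_neg
      - (polyC z).eval x * hBC - (polyB z).eval x * (x ^ 2 - y ^ 2) * hCC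

lemma poisson_dDet : poisson α η k z (dDet α z x) = 0 := by
  refine LinearMap.ker_eq_top.1 (eq_top_of_generators_mem x fun y hxy v hv => ?_)
  refine (mul_eq_zero.1 ?_).resolve_right (sub_ne_zero.2 hxy.symm)
  rcases hv with rfl | rfl | rfl
  exacts [poisson_dDet_dA_mul α η k z x y, poisson_dDet_dB_mul α η k z x y,
    poisson_dDet_dC_mul α η k z x y]

end Casimir

lemma poisson_eq_zero_of_mem_casimirSpan {α : ℂ} {z : Phase n} {u : Phase n →L[ℂ] ℂ}
    (hu : u ∈ casimirSpan α z) (η : ℂ) (k : Fin 2) : poisson α η k z u = 0 :=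
  casimirSpan_le (p := LinearMap.ker (poisson α η k z)) (poisson_dDet α η k z) hu

section Zeros

variable (α η : ℂ) {z : Phase n} {x y : ℂ}

lemma poisson_dA_dA_of_isRoot (k : Fin 2) (hx : (polyB z).eval x = 0) (hy : (polyB z).eval y = 0)
    (hxy : x + y ≠ 0) : poisson α η k z (dA x) (dA y) = 0 := by
  have hAA := evalEval_brAA_mul η k z x y
  rw [hx, hy] at hAA
  rw [poisson_dA_dA]
  exact (mul_eq_zero.1 (hAA.trans (by ring))).resolve_right hxy

lemma poisson_dA_dB_of_isRoot (k : Fin 2) (hx : (polyB z).eval x = 0) (hy : (polyB z).eval y = 0)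
    (hxy : x ^ 2 ≠ y ^ 2) : poisson α η k z (dA x) (dB y) = 0 := by
  have hAB := evalEval_brAB_mul α η k z x y
  rw [hx, hy] at hAB
  rw [poisson_dA_dB]
  exact (mul_eq_zero.1 (hAB.trans (by ring))).resolve_right (sub_ne_zero.2 hxy)

lemma poisson_zero_dA_dB_self (hx : (polyB z).eval x = 0) (hx₀ : x ≠ 0) :
    poisson α η 0 z (dA x) (dB x) =
      -η * (polyA α z).eval x * (derivative (polyB z)).eval x := by
  have hpoly : (brAB α η 0 z).eval (C x) * (X ^ 2 - C x ^ 2) =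
      C η * polyB z * (C ((polyA α z).eval (-x)) * (X - C x)
        - C ((polyA α z).eval x) * (X + C x)) := by
    refine Polynomial.funext fun t => ?_
    have hAB := evalEval_brAB_mul α η 0 z t x
    simp only [evalEval, hx, eval_rho, Fin.val_zero, Nat.cast_zero] at hAB
    simp only [eval_mul, eval_sub, eval_add, eval_pow, eval_X, eval_C, hAB]
    ring
  have hderiv := congrArg (fun q => (derivative q).eval x) hpoly
  simp only [derivative_mul, derivative_sub, derivative_add, derivative_pow, derivative_X,
    derivative_C, Nat.cast_ofNat, Nat.add_one_sub_one, pow_one, mul_one, mul_zero, sub_zero,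
    eval_add, eval_mul, eval_sub, eval_pow, eval_X, eval_C, sub_self, zero_add, zero_mul, add_zero,
    zero_sub, mul_neg, hx] at hderiv
  rw [poisson_dA_dB, evalEval]
  refine mul_right_cancel₀ (mul_ne_zero two_ne_zero hx₀) ?_
  linear_combination hderiv

end Zeros

section LinearAlgebra

variable {K V ι : Type*} [Field K] [AddCommGroup V] [Module K V] {S : Submodule K V}

lemma linearIndependent_mkQ_of_dual {Φ : LinearMap.BilinForm K V} (hS : ∀ u ∈ S, Φ u = 0)
    {w v : ι → V} (hdiag : ∀ j, Φ (w j) (v j) ≠ 0) (hoff : ∀ i j, i ≠ j → Φ (w i) (v j) = 0) :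
    LinearIndependent K fun j => S.mkQ (w j) := by
  classical
  have hker : S ≤ LinearMap.ker (LinearMap.pi fun j => Φ.flip (v j)) := fun u hu =>
    funext fun j => LinearMap.congr_fun (hS u hu) (v j)
  refine LinearIndependent.of_comp (S.liftQ _ hker) ?_
  have hsingle : (S.liftQ _ hker ∘ fun j => S.mkQ (w j)) =
      fun j => Pi.single j (Φ (w j) (v j)) := by
    ext i j
    rcases eq_or_ne j i with rfl | hij
    · simp
    · simp [hij, hoff i j hij.symm]
  rw [hsingle]
  exact Pi.linearIndependent_single_of_ne_zero hdiag

lemma le_sup_span_of_linearIndependent_mkQ [Finite ι] {D : Submodule K V} {w ω : ι → V}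
    (hw : LinearIndependent K fun j => S.mkQ (w j)) (hwD : ∀ j, w j ∈ S ⊔ D)
    (hD : D ≤ S ⊔ Submodule.span K (Set.range ω)) : D ≤ S ⊔ Submodule.span K (Set.range w) := by
  cases nonempty_fintype ι
  have hmap (v : ι → V) : (Submodule.span K (Set.range v)).map S.mkQ =
      Submodule.span K (Set.range fun j => S.mkQ (v j)) := by
    rw [Submodule.map_span, ← Set.range_comp]
    rfl
  have hle : Submodule.span K (Set.range fun j => S.mkQ (w j)) ≤
      Submodule.span K (Set.range fun j => S.mkQ (ω j)) := by
    rw [Submodule.span_le, Set.range_subset_iff, ← hmap]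
    intro j
    rw [SetLike.mem_coe, ← Submodule.mem_comap, Submodule.comap_map_mkQ]
    exact sup_le le_sup_left hD (hwD j)
  have : FiniteDimensional K (Submodule.span K (Set.range fun j => S.mkQ (ω j))) :=
    FiniteDimensional.span_of_finite K (Set.finite_range _)
  have heq := Submodule.eq_of_le_of_finrank_le hle <|
    (finrank_range_le_card _).trans (finrank_span_eq_card hw).ge
  rwa [← Submodule.comap_map_mkQ, hmap, heq, ← hmap, Submodule.comap_map_mkQ]

end LinearAlgebra

/-- A choice of `n` generic separated variables at `z`: simple zeros of `B(λ)` with distinct nonzero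
squares, at which `A(λ)` does not vanish. -/
structure IsGenericRoots (α : ℂ) (z : Phase n) (r : Fin n → ℂ) : Prop where
  isRoot (j : Fin n) : (polyB z).eval (r j) = 0
  ne_zero (j : Fin n) : r j ≠ 0
  sq_injective : Function.Injective fun j => r j ^ 2
  derivative_ne_zero (j : Fin n) : (derivative (polyB z)).eval (r j) ≠ 0
  polyA_ne_zero (j : Fin n) : (polyA α z).eval (r j) ≠ 0

/-- The general covector attached to the canonical pair of separated variables at a zero `x` of
`B(λ)`, namely `x` itself, with `dx` proportional to `dB x`, and `A(x)`. -/
def rootCovector (s t x : ℂ) : Phase n →L[ℂ] ℂ := s • dA x + t • dB x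

section RootCovector

variable (α η : ℂ) (k : Fin 2) {z : Phase n} (s t s' t' : ℂ) {x y : ℂ}

lemma poisson_rootCovector_of_sq_ne (hx : (polyB z).eval x = 0) (hy : (polyB z).eval y = 0)
    (hxy : x ^ 2 ≠ y ^ 2) :
    poisson α η k z (rootCovector s t x) (rootCovector s' t' y) = 0 := by
  simp only [rootCovector, map_add, map_smul, LinearMap.add_apply, LinearMap.smul_apply,
    poisson_dA_dA_of_isRoot α η k hx hy (add_ne_zero_of_sq_ne_sq hxy),
    poisson_dA_dB_of_isRoot α η k hx hy hxy,
    ← LinearMap.IsAlt.neg (isAlt_poisson α η k z) (dA y) (dB x), poisson_dB_dB,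
    poisson_dA_dB_of_isRoot α η k hy hx hxy.symm, neg_zero, smul_zero, add_zero]

lemma poisson_rootCovector_self (z : Phase n) (x : ℂ) :
    poisson α η k z (rootCovector s t x) (rootCovector s' t' x) =
      (s * t' - t * s') * poisson α η k z (dA x) (dB x) := by
  simp only [rootCovector, map_add, map_smul, LinearMap.add_apply, LinearMap.smul_apply,
    (isAlt_poisson α η k z).self_eq_zero, smul_eq_mul,
    ← LinearMap.IsAlt.neg (isAlt_poisson α η k z) (dA x) (dB x)]
  ring

end RootCovector

namespace IsGenericRoots

variable {α : ℂ} {z : Phase n} {r s t : Fin n → ℂ}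

lemma linearIndependent_mkQ_rootCovector (hr : IsGenericRoots α z r)
    (hst : ∀ j, s j ≠ 0 ∨ t j ≠ 0) :
    LinearIndependent ℂ fun j => (casimirSpan α z).mkQ (rootCovector (s j) (t j) (r j)) := by
  have hdual (j : Fin n) : ∃ s' t' : ℂ, s j * t' - t j * s' ≠ 0 := by
    rcases hst j with hs | ht
    · exact ⟨0, 1, by simpa using hs⟩
    · exact ⟨1, 0, by simpa using ht⟩
  choose s' t' hdual using hdual
  refine linearIndependent_mkQ_of_dual (Φ := poisson α 1 0 z)
    (v := fun j => rootCovector (s' j) (t' j) (r j))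
    (fun u hu => poisson_eq_zero_of_mem_casimirSpan hu 1 0) (fun j => ?_) fun i j hij =>
      poisson_rootCovector_of_sq_ne _ _ _ _ _ _ _ (hr.isRoot i) (hr.isRoot j)
        (hr.sq_injective.ne hij)
  rw [poisson_rootCovector_self, poisson_zero_dA_dB_self α 1 (hr.isRoot j) (hr.ne_zero j)]
  exact mul_ne_zero (hdual j) <| mul_ne_zero
    (mul_ne_zero (neg_ne_zero.2 one_ne_zero) (hr.polyA_ne_zero j)) (hr.derivative_ne_zero j)

lemma poisson_eq_zero_of_mem_span (hr : IsGenericRoots α z r) (η : ℂ) (k : Fin 2)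
    {u v : Phase n →L[ℂ] ℂ}
    (hu : u ∈ casimirSpan α z ⊔ .span ℂ (Set.range fun j => rootCovector (s j) (t j) (r j)))
    (hv : v ∈ casimirSpan α z ⊔ .span ℂ (Set.range fun j => rootCovector (s j) (t j) (r j))) :
    poisson α η k z u v = 0 := by
  obtain ⟨u₀, hu₀, u₁, hu₁, rfl⟩ := Submodule.mem_sup.1 hu
  obtain ⟨v₀, hv₀, v₁, hv₁, rfl⟩ := Submodule.mem_sup.1 hv
  have hroot : poisson α η k z u₁ v₁ ∈ (⊥ : Submodule ℂ ℂ) := by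
    refine LinearMap.BilinMap.apply_apply_mem_of_mem_span ⊥ _ _ _ ?_ u₁ v₁ hu₁ hv₁
    rintro _ ⟨i, rfl⟩ _ ⟨j, rfl⟩
    rcases eq_or_ne i j with rfl | hij
    · exact (isAlt_poisson α η k z).self_eq_zero _
    · exact poisson_rootCovector_of_sq_ne _ _ _ _ _ _ _ (hr.isRoot i) (hr.isRoot j)
        (hr.sq_injective.ne hij)
  rw [map_add (poisson α η k z), poisson_eq_zero_of_mem_casimirSpan hu₀, zero_add, map_add,
    ← LinearMap.IsAlt.neg (isAlt_poisson α η k z) v₀ u₁, poisson_eq_zero_of_mem_casimirSpan hv₀,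
    LinearMap.zero_apply, neg_zero, zero_add]
  exact hroot

theorem poisson_eq_zero (hr : IsGenericRoots α z r) (hst : ∀ j, s j ≠ 0 ∨ t j ≠ 0)
    {D : Submodule ℂ (Phase n →L[ℂ] ℂ)}
    (hwD : ∀ j, rootCovector (s j) (t j) (r j) ∈ casimirSpan α z ⊔ D)
    {ω : Fin n → Phase n →L[ℂ] ℂ} (hD : D ≤ casimirSpan α z ⊔ .span ℂ (Set.range ω)) (η : ℂ)
    (k : Fin 2) {u v : Phase n →L[ℂ] ℂ} (hu : u ∈ D) (hv : v ∈ D) : poisson α η k z u v = 0 := by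
  have hle := le_sup_span_of_linearIndependent_mkQ (hr.linearIndependent_mkQ_rootCovector hst)
    hwD hD
  exact hr.poisson_eq_zero_of_mem_span η k (hle hu) (hle hv)

end IsGenericRoots

section Coprime

lemma isOpen_and_dense_ne_zero {𝕜 E : Type*} [NontriviallyNormedField 𝕜] [NormedAddCommGroup E]
    [NormedSpace 𝕜 E] [PreconnectedSpace E] {f : E → 𝕜} (hf : AnalyticOnNhd 𝕜 f Set.univ) {w : E}
    (hw : f w ≠ 0) : IsOpen {z | f z ≠ 0} ∧ Dense {z | f z ≠ 0} := by
  refine ⟨isOpen_ne_fun (continuousOn_univ.1 hf.continuousOn) continuous_const, ?_⟩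
  refine dense_iff_inter_open.2 fun V hV ⟨z₀, hz₀⟩ => ?_
  by_contra! hempty
  refine hw (hf.eqOn_zero_of_preconnected_of_eventuallyEq_zero isPreconnected_univ
    (Set.mem_univ z₀) ?_ (Set.mem_univ w))
  filter_upwards [hV.mem_nhds hz₀] with z hz
  by_contra hne
  exact Set.notMem_empty z (hempty ▸ ⟨hz, hne⟩)

lemma IsAnalyticFamily.isOpen_and_dense_isCoprime {𝕜 E : Type*} [NontriviallyNormedField 𝕜]
    [NormedAddCommGroup E] [NormedSpace 𝕜 E] [PreconnectedSpace E] {F G : E → 𝕜[X]} {m : ℕ}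
    (hF : IsAnalyticFamily F Set.univ) (hG : IsAnalyticFamily G Set.univ)
    (hmonic : ∀ z, (F z).Monic) (hdeg : ∀ z, (F z).natDegree = m) {w : E}
    (hw : IsCoprime (F w) (G w)) :
    IsOpen {z | IsCoprime (F z) (G z)} ∧ Dense {z | IsCoprime (F z) (G z)} := by
  obtain ⟨L, hL⟩ := hG.1
  have hres (z : E) : resultant (F z) (G z) m L = resultant (F z) (G z) := by
    obtain ⟨k, hk⟩ := Nat.exists_eq_add_of_le (hL z).le
    have hlead : (F z).coeff m = 1 := by
      rw [← hdeg z]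
      exact hmonic z
    rw [hk, resultant_add_right_deg _ _ _ _ _ le_rfl, hlead, one_pow, one_mul, hdeg]
  have hiff (z : E) : resultant (F z) (G z) m L ≠ 0 ↔ IsCoprime (F z) (G z) := by
    rw [hres, ← isUnit_iff_ne_zero, isUnit_resultant_iff_isCoprime (hmonic z)]
  have hanalytic : AnalyticOnNhd 𝕜 (fun z => resultant (F z) (G z) m L) Set.univ := by
    simp only [resultant, Matrix.det_apply']
    refine Finset.analyticOnNhd_fun_sum _ fun σ _ => ?_
    refine analyticOnNhd_const.mul (Finset.analyticOnNhd_fun_prod _ fun i _ => ?_)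
    simp only [sylvester, Matrix.of_apply]
    cases i using Fin.addCases <;> simp only [Fin.addCases_left, Fin.addCases_right] <;>
      split_ifs <;> first | exact hF.2 _ | exact hG.2 _ | exact analyticOnNhd_const
  simp only [← hiff] at hw ⊢
  exact isOpen_and_dense_ne_zero hanalytic hw

variable {K : Type*} [Field K] [IsAlgClosed K]

lemma isCoprime_iff_forall_eval_ne_zero {f g : K[X]} :
    IsCoprime f g ↔ ∀ r, f.eval r = 0 → g.eval r ≠ 0 := by
  simp only [isCoprime_iff_aeval_ne_zero_of_isAlgClosed K K, coe_aeval_eq_eval, ne_eq,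
    or_iff_not_imp_left, not_not]

lemma exists_isCoprime_X_pow_sub_C (m : ℕ) {f : K[X]} (hf : f ≠ 0) :
    ∃ s : K, IsCoprime (X ^ m - C s) f := by
  obtain ⟨s, hs⟩ := ((finite_setOfPred_isRoot hf).image (· ^ m)).exists_notMem
  refine ⟨s, isCoprime_iff_forall_eval_ne_zero.2 fun r hr h => hs ⟨r, h, ?_⟩⟩
  simpa only [eval_sub, eval_pow, eval_X, eval_C, sub_eq_zero] using hr

end Coprime

/-- The polynomial `B(λ) / λ` in the variable `λ²`. -/
def sqB (z : Phase n) : ℂ[X] := X ^ n + ∑ i : Fin n, C (z (genB i)) * X ^ (i : ℕ)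

/-- The polynomial `B(λ) / λ`. -/
def redB (z : Phase n) : ℂ[X] := X ^ (2 * n) + ∑ i : Fin n, C (z (genB i)) * X ^ (2 * (i : ℕ))

lemma redB_eq_sqB_comp (z : Phase n) : redB z = (sqB z).comp (X ^ 2) := by
  simp only [redB, sqB, Polynomial.sum_comp, add_comp, mul_comp, C_comp, pow_comp, X_comp, pow_mul]

lemma polyB_eq_X_mul_redB (z : Phase n) : polyB z = X * redB z := by
  rw [polyB, redB, mul_add, Finset.mul_sum, pow_succ', add_right_inj]
  exact Finset.sum_congr rfl fun _ _ => by ring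

lemma monic_sqB (z : Phase n) : (sqB z).Monic :=
  monic_X_pow_add (degree_sum_fin_lt fun i => z (genB i))

lemma natDegree_sqB (z : Phase n) : (sqB z).natDegree = n := by
  refine (natDegree_add_eq_left_of_degree_lt ?_).trans (natDegree_X_pow n)
  rw [degree_X_pow]
  exact degree_sum_fin_lt fun i => z (genB i)

lemma monic_redB (z : Phase n) : (redB z).Monic := by
  rw [redB_eq_sqB_comp]
  refine (monic_sqB z).comp (monic_X_pow 2) ?_
  rw [natDegree_X_pow]
  exact two_ne_zero

lemma natDegree_redB (z : Phase n) : (redB z).natDegree = 2 * n := by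
  rw [redB_eq_sqB_comp, natDegree_comp, natDegree_sqB, natDegree_X_pow, mul_comm]

lemma isOpen_and_dense_isCoprime_redB {Q : Phase n → ℂ[X]} (hQ : IsAnalyticFamily Q Set.univ)
    {w : Phase n} (hw : IsCoprime (redB w) (Q w)) :
    IsOpen {z | IsCoprime (redB z) (Q z)} ∧ Dense {z | IsCoprime (redB z) (Q z)} := by
  have hredB : IsAnalyticFamily (redB (n := n)) Set.univ :=
    (IsAnalyticFamily.const _ _).add <| .sum fun _ _ =>
      (IsAnalyticFamily.C_comp (analyticOnNhd_apply _ _)).mul (.const _ _)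
  exact hredB.isOpen_and_dense_isCoprime hQ monic_redB natDegree_redB hw

lemma exists_redB_eq_polyA_eq (hn : n ≠ 0) (α s : ℂ) {q : ℂ[X]} (hq : q.natDegree ≤ 1) :
    ∃ z : Phase n, redB z = X ^ (2 * n) - C s ∧ polyA α z = C α * polyB z + q := by
  have : NeZero n := ⟨hn⟩
  let q₀ := q - C (α * s) * X ^ 1
  have hq₀ : q₀.natDegree < 2 * n + 1 := by
    have := natDegree_sub_le_of_le hq (natDegree_C_mul_X_pow_le (α * s) 1)
    lia
  let z : Phase n := Sum.elim (fun i => q₀.coeff i) (Sum.elim (Pi.single 0 (-s)) 0)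
  have hB : redB z = X ^ (2 * n) - C s := by
    rw [redB, sub_eq_add_neg, add_right_inj, Finset.sum_eq_single 0]
    · simp [z]
    · intro i _ hi
      simp [z, hi]
    · simp
  refine ⟨z, hB, ?_⟩
  have hA : ∑ i : Fin (2 * n + 1), C (z (genA i)) * X ^ (i : ℕ) = q₀ := by
    rw [q₀.as_sum_range_C_mul_X_pow' hq₀, Finset.sum_range]
    rfl
  rw [polyA, hA, polyB_eq_X_mul_redB, hB]
  simp only [q₀, C_mul]
  ring

lemma exists_isCoprime_redB_derivative_polyB :
    ∃ w : Phase n, IsCoprime (redB w) (derivative (polyB w)) := by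
  rcases eq_or_ne n 0 with rfl | hn
  · exact ⟨0, by simpa [redB] using isCoprime_one_left⟩
  obtain ⟨w, hB, -⟩ := exists_redB_eq_polyA_eq hn 0 1 (natDegree_zero.trans_le zero_le_one)
  refine ⟨w, isCoprime_iff_forall_eval_ne_zero.2 fun r hr => ?_⟩
  rw [polyB_eq_X_mul_redB, hB]
  rw [hB] at hr
  have hpow : r ^ (2 * n) = 1 := by simpa [sub_eq_zero] using hr
  have hderiv : r * (2 * (n : ℂ) * r ^ (2 * n - 1)) = 2 * n := by
    rw [mul_left_comm, mul_pow_sub_one (by lia), hpow, mul_one]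
  simp [derivative_X_pow, hpow, hderiv, hn]

lemma exists_isCoprime_redB_combination (α : ℂ) {a d : ℂ[X]} (had : a ≠ 0 ∨ d ≠ 0) :
    ∃ w : Phase n, IsCoprime (redB w) (a * polyA α w - d * (polyA α w).comp (-X)) := by
  rcases eq_or_ne n 0 with rfl | hn
  · exact ⟨0, by simpa [redB] using isCoprime_one_left⟩
  obtain ⟨f, hf, q, hq, hval⟩ : ∃ f : ℂ[X], f ≠ 0 ∧ ∃ q : ℂ[X], q.natDegree ≤ 1 ∧
      ∀ r, a.eval r * q.eval r - d.eval r * q.eval (-r) = f.eval r := by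
    rcases eq_or_ne a d with rfl | hne
    · refine ⟨C 2 * X * a, ?_, X, natDegree_X_le, fun r => ?_⟩
      · simpa using had
      · simp only [eval_mul, eval_C, eval_X]
        ring
    · refine ⟨a - d, sub_ne_zero.2 hne, 1, natDegree_one.trans_le zero_le_one, fun r => ?_⟩
      simp only [eval_one, mul_one, eval_sub]
  obtain ⟨s, hs⟩ := exists_isCoprime_X_pow_sub_C (2 * n) hf
  obtain ⟨w, hB, hA⟩ := exists_redB_eq_polyA_eq hn α s hq
  refine ⟨w, isCoprime_iff_forall_eval_ne_zero.2 fun r hr => ?_⟩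
  have hroot : (polyB w).eval r = 0 := by rw [polyB_eq_X_mul_redB, eval_mul, hr, mul_zero]
  simp only [eval_sub, eval_mul, eval_comp, eval_neg, eval_X, hA, eval_add, eval_polyB_neg, hroot,
    neg_zero, mul_zero, zero_add, hval]
  rw [hB] at hr
  exact isCoprime_iff_forall_eval_ne_zero.1 hs r hr

lemma separable_sqB {z : Phase n} (h : IsCoprime (redB z) (derivative (polyB z))) :
    (sqB z).Separable := by
  refine isCoprime_iff_forall_eval_ne_zero.2 fun y hy => ?_
  obtain ⟨x, rfl⟩ := IsAlgClosed.exists_pow_nat_eq y two_pos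
  have hx : (redB z).eval x = 0 := by
    simpa only [redB_eq_sqB_comp, eval_comp, eval_pow, eval_X] using hy
  have hne := isCoprime_iff_forall_eval_ne_zero.1 h x hx
  rw [polyB_eq_X_mul_redB, derivative_mul, derivative_X, one_mul, eval_add, hx, zero_add,
    redB_eq_sqB_comp, derivative_comp] at hne
  simp only [eval_mul, eval_comp, eval_pow, eval_X] at hne
  exact right_ne_zero_of_mul (right_ne_zero_of_mul hne)

lemma exists_isGenericRoots {α : ℂ} {z : Phase n} (hB : IsCoprime (redB z) (derivative (polyB z)))
    (hA : IsCoprime (redB z) (polyA α z)) : ∃ r, IsGenericRoots α z r := by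
  have hcard := card_rootSet_eq_natDegree (K := ℂ) (separable_sqB hB) (IsAlgClosed.splits _)
  let e := Fintype.equivFinOfCardEq (hcard.trans (natDegree_sqB z))
  choose r hr using fun j => IsAlgClosed.exists_pow_nat_eq (e.symm j : ℂ) two_pos
  have hroot (j : Fin n) : (redB z).eval (r j) = 0 := by
    rw [redB_eq_sqB_comp, eval_comp, eval_pow, eval_X, hr]
    simpa using (mem_rootSet.1 (e.symm j).2).2
  have hderiv (j : Fin n) := isCoprime_iff_forall_eval_ne_zero.1 hB _ (hroot j)
  refine ⟨r, fun j => ?_, fun j hj => hderiv j ?_, fun i j hij => ?_, hderiv,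
    fun j => isCoprime_iff_forall_eval_ne_zero.1 hA _ (hroot j)⟩
  · rw [polyB_eq_X_mul_redB, eval_mul, hroot, mul_zero]
  · rw [polyB_eq_X_mul_redB, derivative_mul, derivative_X, one_mul, eval_add, hroot, eval_mul,
      eval_X, hj, zero_mul, zero_add]
  · exact e.symm.injective (Subtype.ext ((hr i).symm.trans (hij.trans (hr j))))

lemma IsGenericRoots.eval_ne_zero_of_isCoprime {α : ℂ} {z : Phase n} {r : Fin n → ℂ}
    (hr : IsGenericRoots α z r) {Q : ℂ[X]} (hQ : IsCoprime (redB z) Q) (j : Fin n) :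
    Q.eval (r j) ≠ 0 := by
  refine isCoprime_iff_forall_eval_ne_zero.1 hQ _ ?_
  have hroot := hr.isRoot j
  rw [polyB_eq_X_mul_redB, eval_mul, eval_X] at hroot
  exact (mul_eq_zero.1 hroot).resolve_left (hr.ne_zero j)

theorem exists_isOpen_dense_isGenericRoots (α : ℂ) :
    ∃ G : Set (Phase n), IsOpen G ∧ Dense G ∧ ∀ z ∈ G, ∃ r, IsGenericRoots α z r := by
  obtain ⟨w, hw⟩ := exists_isCoprime_redB_derivative_polyB (n := n)
  obtain ⟨w', hw'⟩ := exists_isCoprime_redB_combination (n := n) α (a := 1) (d := 0)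
    (.inl one_ne_zero)
  rw [one_mul, zero_mul, sub_zero] at hw'
  obtain ⟨hopen, hdense⟩ :=
    isOpen_and_dense_isCoprime_redB (isAnalyticFamily_polyB Set.univ).derivative hw
  obtain ⟨hopen', hdense'⟩ :=
    isOpen_and_dense_isCoprime_redB (isAnalyticFamily_polyA Set.univ α) hw'
  exact ⟨_, hopen.inter hopen', hdense.inter_of_isOpen_left hdense' hopen,
    fun z hz => exists_isGenericRoots hz.1 hz.2⟩

section CoeffSpan

open Filter Topology

variable {𝕜 E : Type*} [RCLike 𝕜] [NormedAddCommGroup E] [NormedSpace 𝕜 E] {F : E → 𝕜[X]}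
  {U : Set E} {ρ : E → 𝕜} {z : E}

namespace IsAnalyticFamily

lemma coeffSpan_derivative_le (hF : IsAnalyticFamily F U) (hz : z ∈ U) :
    coeffSpan (fun w => Polynomial.derivative (F w)) z ≤ coeffSpan F z := by
  refine Submodule.span_le.2 ?_
  rintro _ ⟨l, rfl⟩
  simp only [coeff_derivative, SetLike.mem_coe]
  rw [fderiv_mul_const (hF.2 _ z hz).differentiableAt]
  exact Submodule.smul_mem _ _ (fderiv_coeff_mem_coeffSpan F _ z)

lemma neg_fderiv_eval_eq_of_isRoot (hF : IsAnalyticFamily F U) (hz : z ∈ U)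
    (hρ : DifferentiableAt 𝕜 ρ z) (hroot : ∀ᶠ w in 𝓝 z, (F w).IsRoot (ρ w)) :
    -fderiv 𝕜 (fun w => (F w).eval (ρ z)) z
      = (Polynomial.derivative (F z)).eval (ρ z) • fderiv 𝕜 ρ z :=
  neg_eq_of_add_eq_zero_right <| ((hF.hasFDerivAt_eval_comp hz
    hρ.hasFDerivAt).congr_of_eventuallyEq <| hroot.mono fun _ => Eq.symm).unique
      (hasFDerivAt_const 0 z)

/-- A root function of a family `F` which is not identically zero is a simple root function of some
iterated derivative `G` of `F` on a smaller open set, and there `dρ = -dG(ρ) / G'(ρ)`. -/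
theorem exists_isOpen_fderiv_mem_coeffSpan (hF : IsAnalyticFamily F U) (hU : IsOpen U)
    (hρ : ∀ z ∈ U, DifferentiableAt 𝕜 ρ z) (hroot : ∀ z ∈ U, (F z).IsRoot (ρ z)) {w : E}
    (hw : w ∈ U) (hFw : F w ≠ 0) :
    ∃ W ⊆ U, IsOpen W ∧ W.Nonempty ∧ ∀ z ∈ W, fderiv 𝕜 ρ z ∈ coeffSpan F z := by
  obtain ⟨L, hL⟩ := hF.1
  induction L generalizing F with
  | zero => exact absurd (hL w) (Nat.not_lt_zero _)
  | succ L ih =>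
    by_cases hder : ∀ z ∈ U, (Polynomial.derivative (F z)).IsRoot (ρ z)
    · have hdeg : (F w).natDegree ≠ 0 := fun h => hFw <| by
        have hFρ := hroot w hw
        rw [eq_C_of_natDegree_eq_zero h, IsRoot.def, eval_C] at hFρ
        rw [eq_C_of_natDegree_eq_zero h, hFρ, C_0]
      obtain ⟨W, hWU, hW, hWne, hmem⟩ := ih hF.derivative hder
        (fun h => hdeg (derivative_eq_zero.1 h)) fun z =>
          (natDegree_derivative_le _).trans_lt (by have := hL z; have := hL w; lia)
      exact ⟨W, hWU, hW, hWne, fun z hz => hF.coeffSpan_derivative_le (hWU hz) (hmem z hz)⟩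
    · push Not at hder
      obtain ⟨z₀, hz₀, hne⟩ := hder
      refine ⟨_, Set.inter_subset_left, ContinuousOn.isOpen_inter_preimage
        (fun z hz => (hF.derivative.hasFDerivAt_eval_comp hz
          (hρ z hz).hasFDerivAt).continuousAt.continuousWithinAt)
        hU (isOpen_compl_singleton (x := 0)), ⟨z₀, hz₀, hne⟩, fun z ⟨hz, hz'⟩ => ?_⟩
      refine (Submodule.smul_mem_iff _ hz').1 ?_
      rw [← hF.neg_fderiv_eval_eq_of_isRoot hz (hρ z hz)
        (eventually_of_mem (hU.mem_nhds hz) hroot)]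
      exact neg_mem (hF.fderiv_eval_mem_coeffSpan hz _)

lemma exists_eventually_isRoot [CompleteSpace E] (hF : IsAnalyticFamily F U) (hz : z ∈ U) {x : 𝕜}
    (hx : (F z).IsRoot x) (hx' : (Polynomial.derivative (F z)).eval x ≠ 0) :
    ∃ ρ : E → 𝕜, ρ z = x ∧ ∀ᶠ w in 𝓝 z, DifferentiableAt 𝕜 ρ w ∧ (F w).IsRoot (ρ w) := by
  obtain ⟨L, hL⟩ := hF.1
  have hf : ContDiffAt 𝕜 1 (fun p : E × 𝕜 => (F p.1).eval p.2) (z, x) := by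
    simp only [fun p : E × 𝕜 => eval_eq_sum_range' (hL p.1) p.2]
    exact ContDiffAt.sum fun l _ =>
      ((hF.2 l z hz).contDiffAt.comp (z, x) contDiffAt_fst).mul (contDiffAt_snd.pow l)
  have hderiv : fderiv 𝕜 (fun p : E × 𝕜 => (F p.1).eval p.2) (z, x) ∘L .inr 𝕜 E 𝕜 =
      .toSpanSingleton 𝕜 ((Polynomial.derivative (F z)).eval x) :=
    (((hf.differentiableAt one_ne_zero).hasFDerivAt).comp x (hasFDerivAt_prodMk_right z x)).unique
      ((F z).hasDerivAt x).hasFDerivAt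
  have hinv : (fderiv 𝕜 (fun p : E × 𝕜 => (F p.1).eval p.2) (z, x) ∘L
      .inr 𝕜 E 𝕜).IsInvertible := by
    refine ⟨.unitsEquivAut 𝕜 (Units.mk0 _ hx'), ?_⟩
    rw [hderiv]
    ext
    simp
  refine ⟨hf.implicitFunction one_ne_zero hinv, hf.implicitFunction_apply_self _ hinv, ?_⟩
  filter_upwards [(hf.contDiffAt_implicitFunction one_ne_zero hinv).eventually (by simp),
    hf.eventually_apply_implicitFunction one_ne_zero hinv] with w hw hw'
  exact ⟨hw.differentiableAt one_ne_zero, hw'.trans hx⟩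

end IsAnalyticFamily

end CoeffSpan

section Separation

open Filter Topology

lemma exists_isOpen_forall {X ι : Type*} [TopologicalSpace X] [Finite ι] {Q : ι → X → Prop}
    {V : Set X} (hV : IsOpen V) (hne : V.Nonempty)
    (h : ∀ i, ∀ W ⊆ V, IsOpen W → W.Nonempty →
      ∃ W' ⊆ W, IsOpen W' ∧ W'.Nonempty ∧ ∀ z ∈ W', Q i z) :
    ∃ W ⊆ V, IsOpen W ∧ W.Nonempty ∧ ∀ z ∈ W, ∀ i, Q i z := by
  suffices hs : ∀ s : Set ι, s.Finite →
      ∃ W ⊆ V, IsOpen W ∧ W.Nonempty ∧ ∀ z ∈ W, ∀ i ∈ s, Q i z by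
    simpa only [Set.mem_univ, forall_const] using hs Set.univ Set.finite_univ
  intro s hs
  induction s, hs using Set.Finite.induction_on with
  | empty => exact ⟨V, subset_rfl, hV, hne, fun z _ i hi => hi.elim⟩
  | @insert i s _ _ ih =>
    obtain ⟨W, hWV, hW, hWne, hQ⟩ := ih
    obtain ⟨W', hW'W, hW', hW'ne, hQ'⟩ := h i W hWV hW hWne
    exact ⟨W', hW'W.trans hWV, hW', hW'ne, fun z hz =>
      Set.forall_mem_insert.2 ⟨hQ' z hz, hQ z (hW'W hz)⟩⟩

lemma IsGenericRoots.exists_eventually {α : ℂ} {z : Phase n} {r : Fin n → ℂ}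
    (hr : IsGenericRoots α z r) : ∃ ρ : Fin n → Phase n → ℂ, ∀ᶠ w in 𝓝 z,
      (∀ j, DifferentiableAt ℂ (ρ j) w) ∧ IsGenericRoots α w fun j => ρ j w := by
  have hB := isAnalyticFamily_polyB (n := n) Set.univ
  choose ρ hρz hρ using fun j => hB.exists_eventually_isRoot (Set.mem_univ z)
    (hr.isRoot j) (hr.derivative_ne_zero j)
  have hdiff (j : Fin n) : DifferentiableAt ℂ (ρ j) z := (hρ j).self_of_nhds.1
  have hcont {F : Phase n → ℂ[X]} (hF : IsAnalyticFamily F Set.univ) (j : Fin n) :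
      ContinuousAt (fun w => (F w).eval (ρ j w)) z :=
    (hF.hasFDerivAt_eval_comp (Set.mem_univ z) (hdiff j).hasFDerivAt).continuousAt
  refine ⟨ρ, ?_⟩
  have hne (j : Fin n) : ∀ᶠ w in 𝓝 z, ρ j w ≠ 0 ∧ (derivative (polyB w)).eval (ρ j w) ≠ 0 ∧
      (polyA α w).eval (ρ j w) ≠ 0 :=
    ((hdiff j).continuousAt.eventually_ne (hρz j ▸ hr.ne_zero j)).and <|
      ((hcont hB.derivative j).eventually_ne (hρz j ▸ hr.derivative_ne_zero j)).and <|
      (hcont (isAnalyticFamily_polyA Set.univ α) j).eventually_ne (hρz j ▸ hr.polyA_ne_zero j)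
  have hsq (i j : Fin n) : ∀ᶠ w in 𝓝 z, ρ i w ^ 2 = ρ j w ^ 2 → i = j := by
    rcases eq_or_ne i j with rfl | hij
    · exact .of_forall fun _ _ => rfl
    · have hzne : ρ i z ^ 2 - ρ j z ^ 2 ≠ 0 := by
        rw [hρz, hρz]
        exact sub_ne_zero.2 (hr.sq_injective.ne hij)
      exact ((((hdiff i).pow 2).sub ((hdiff j).pow 2)).continuousAt.eventually_ne hzne).mono
        fun w hw h => absurd (sub_eq_zero.2 h) hw
  filter_upwards [eventually_all.2 hρ, eventually_all.2 hne,
    eventually_all.2 fun i => eventually_all.2 (hsq i)] with w hρw hnew hsqw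
  exact ⟨fun j => (hρw j).1, ⟨fun j => (hρw j).2, fun j => (hnew j).1, fun i j => hsqw i j,
    fun j => (hnew j).2.1, fun j => (hnew j).2.2⟩⟩

theorem exists_isOpen_dB_mem_coeffSpan (α : ℂ) {F : Phase n → ℂ[X]} {V : Set (Phase n)}
    (hF : IsAnalyticFamily F V) (hV : IsOpen V) (hne : V.Nonempty)
    (hdvd : ∀ z ∈ V, polyB z ∣ F z) (hF0 : ∀ z ∈ V, F z ≠ 0) :
    ∃ W ⊆ V, IsOpen W ∧ W.Nonempty ∧
      ∀ z ∈ W, ∃ r, IsGenericRoots α z r ∧ ∀ j, dB (r j) ∈ coeffSpan F z := by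
  obtain ⟨G, -, hGdense, hG⟩ := exists_isOpen_dense_isGenericRoots (n := n) α
  obtain ⟨z₀, hz₀V, hz₀G⟩ := hGdense.inter_open_nonempty V hV hne
  obtain ⟨r, hr⟩ := hG z₀ hz₀G
  obtain ⟨ρ, hρ⟩ := hr.exists_eventually
  obtain ⟨V', hV', hV'open, hz₀V'⟩ := eventually_nhds_iff.1 (hρ.and (hV.mem_nhds hz₀V))
  obtain ⟨W, hWV', hW, hWne, hmem⟩ :=
      exists_isOpen_forall (Q := fun j z => fderiv ℂ (ρ j) z ∈ coeffSpan F z) hV'open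
      ⟨z₀, hz₀V'⟩ fun j W hWV' hW ⟨w, hw⟩ => by
    have hWV : W ⊆ V := fun z hz => (hV' z (hWV' hz)).2
    exact (hF.mono hWV).exists_isOpen_fderiv_mem_coeffSpan hW
      (fun z hz => (hV' z (hWV' hz)).1.1 j)
      (fun z hz => IsRoot.dvd ((hV' z (hWV' hz)).1.2.isRoot j) (hdvd z (hWV hz)))
      hw (hF0 w (hWV hw))
  refine ⟨W, fun z hz => (hV' z (hWV' hz)).2, hW, hWne, fun z hz =>
    ⟨fun j => ρ j z, (hV' z (hWV' hz)).1.2, fun j => ?_⟩⟩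
  have hdB := (isAnalyticFamily_polyB Set.univ).neg_fderiv_eval_eq_of_isRoot (Set.mem_univ z)
    ((hV' z (hWV' hz)).1.1 j) <|
    eventually_of_mem (hV'open.mem_nhds (hWV' hz)) fun w hw => (hV' w hw).1.2.isRoot j
  rw [(hasFDerivAt_eval_polyB _ z).fderiv] at hdB
  exact neg_mem_iff.1 (hdB ▸ Submodule.smul_mem _ _ (hmem z hz j))

end Separation

section Tau

/-- The polynomial `𝒞(λ)` at a point of the phase space. -/
def polyK (c : (Phase n → ℂ)[X]) (z : Phase n) : ℂ[X] :=
  c.map (Pi.evalRingHom (fun _ : Phase n => ℂ) z)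

/-- The generating function `τ(λ) = tr K(λ) T(λ)` of the integrals. -/
def tau (α : ℂ) (a d : ℂ[X]) (c : (Phase n → ℂ)[X]) (z : Phase n) : ℂ[X] :=
  (matK a d c z * matT α z).trace

variable {α : ℂ} {a d : ℂ[X]} {c : (Phase n → ℂ)[X]} {U : Set (Phase n)}

lemma tau_eq (z : Phase n) :
    tau α a d c z = a * polyA α z + polyK c z * polyB z + d * (polyA α z).comp (-X) := by
  simp only [tau, matK, matT, polyK, Matrix.trace_fin_two, Matrix.mul_apply, Fin.sum_univ_two,
    Matrix.of_apply, Matrix.cons_val]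
  ring

lemma isAnalyticFamily_polyK (hc : ∀ l, AnalyticOnNhd ℂ (c.coeff l) U) :
    IsAnalyticFamily (polyK c) U :=
  ⟨⟨_, fun _ => natDegree_map_le.trans_lt (Nat.lt_succ_self _)⟩,
    fun l => by
      simp only [polyK, coeff_map]
      exact hc l⟩

lemma isAnalyticFamily_tau (hc : ∀ l, AnalyticOnNhd ℂ (c.coeff l) U) :
    IsAnalyticFamily (tau α a d c) U := by
  rw [funext tau_eq]
  exact (((IsAnalyticFamily.const a U).mul (isAnalyticFamily_polyA U α)).add
    ((isAnalyticFamily_polyK hc).mul (isAnalyticFamily_polyB U))).add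
    ((IsAnalyticFamily.const d U).mul (isAnalyticFamily_polyA U α).comp_neg_X)

lemma fderiv_eval_tau_of_isRoot (hc : ∀ l, AnalyticOnNhd ℂ (c.coeff l) U) {z : Phase n}
    (hz : z ∈ U) {x : ℂ} (hx : (polyB z).IsRoot x) :
    fderiv ℂ (fun w => (tau α a d c w).eval x) z
      = a.eval x • dA x + (polyK c z).eval x • dB x + d.eval x • dA (-x) := by
  have hK := ((isAnalyticFamily_polyK hc).differentiableAt_eval hz x).hasFDerivAt
  simp only [tau_eq, eval_add, eval_mul, eval_comp, eval_neg, eval_X]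
  refine HasFDerivAt.fderiv ?_
  refine ((((hasFDerivAt_eval_polyA α x z).const_mul _).fun_add
    (hK.fun_mul (hasFDerivAt_eval_polyB x z))).fun_add
    ((hasFDerivAt_eval_polyA α (-x) z).const_mul _)).congr_fderiv ?_
  ext v
  simp only [hx.eq_zero, add_apply, smul_apply, zero_smul, add_zero]

/-- Eliminating `dA(-x)` between the differentials of `τ(x)` and of the Casimir `det T(x)` leaves a
combination of `dA(x)` and `dB(x)`. -/
lemma rootCovector_mem_casimirSpan_sup_coeffSpan (hc : ∀ l, AnalyticOnNhd ℂ (c.coeff l) U)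
    {z : Phase n} (hz : z ∈ U) {x : ℂ} (hx : (polyB z).IsRoot x) :
    rootCovector ((a * polyA α z - d * (polyA α z).comp (-X)).eval x)
      ((polyK c z * polyA α z + d * polyC z).eval x) x
      ∈ casimirSpan α z ⊔ coeffSpan (tau α a d c) z := by
  have hcomb : rootCovector ((a * polyA α z - d * (polyA α z).comp (-X)).eval x)
      ((polyK c z * polyA α z + d * polyC z).eval x) x
      = -d.eval x • dDet α z x
        + (polyA α z).eval x • fderiv ℂ (fun w => (tau α a d c w).eval x) z := by
    rw [fderiv_eval_tau_of_isRoot hc hz hx, rootCovector, dDet, hx.eq_zero]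
    simp only [eval_sub, eval_add, eval_mul, eval_comp, eval_neg, eval_X]
    module
  rw [hcomb]
  exact Submodule.add_mem_sup (Submodule.smul_mem _ _ (dDet_mem_casimirSpan α z x))
    (Submodule.smul_mem _ _ ((isAnalyticFamily_tau hc).fderiv_eval_mem_coeffSpan hz x))

end Tau

section Involution

open Topology

/-- Separation of variables at `z`: the span of the differentials of the coefficients of `F`
contains, modulo the Casimir functions, a nonzero covector attached to each of `n` generic roots of
`B(λ)`. -/
def IsSeparatedAt (α : ℂ) (F : Phase n → ℂ[X]) (z : Phase n) : Prop :=
  ∃ r s t : Fin n → ℂ, IsGenericRoots α z r ∧ (∀ j, s j ≠ 0 ∨ t j ≠ 0) ∧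
    ∀ j, rootCovector (s j) (t j) (r j) ∈ casimirSpan α z ⊔ coeffSpan F z

lemma IsSeparatedAt.poisson_eq_zero {α : ℂ} {F : Phase n → ℂ[X]} {z : Phase n}
    (h : IsSeparatedAt α F z) {ω : Fin n → Phase n →L[ℂ] ℂ}
    (hω : ∀ l, fderiv ℂ (fun w => (F w).coeff l) z
      ∈ casimirSpan α z ⊔ .span ℂ (Set.range ω)) (η : ℂ) (k : Fin 2) (l m : ℕ) :
    poisson α η k z (fderiv ℂ (fun w => (F w).coeff l) z)
      (fderiv ℂ (fun w => (F w).coeff m) z) = 0 := by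
  obtain ⟨r, s, t, hr, hst, hmem⟩ := h
  exact hr.poisson_eq_zero hst hmem (Submodule.span_le.2 (Set.range_subset_iff.2 hω)) η k
    (fderiv_coeff_mem_coeffSpan F l z) (fderiv_coeff_mem_coeffSpan F m z)

variable {α : ℂ} {a d : ℂ[X]} {c : (Phase n → ℂ)[X]} {U V : Set (Phase n)}

lemma exists_isOpen_isSeparatedAt_of_ne_zero (had : a ≠ 0 ∨ d ≠ 0)
    (hc : ∀ l, AnalyticOnNhd ℂ (c.coeff l) U) (hV : IsOpen V) (hne : V.Nonempty) (hVU : V ⊆ U) :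
    ∃ W ⊆ V, IsOpen W ∧ W.Nonempty ∧ ∀ z ∈ W, IsSeparatedAt α (tau α a d c) z := by
  have hA := isAnalyticFamily_polyA (n := n) Set.univ α
  have hQ : IsAnalyticFamily (fun z : Phase n => a * polyA α z - d * (polyA α z).comp (-X))
      Set.univ := ((IsAnalyticFamily.const a _).mul hA).sub ((IsAnalyticFamily.const d _).mul
        hA.comp_neg_X)
  obtain ⟨w, hw⟩ := exists_isCoprime_redB_combination (n := n) α had
  obtain ⟨hopen, hdense⟩ := isOpen_and_dense_isCoprime_redB hQ hw
  obtain ⟨G, hG, hGdense, hroots⟩ := exists_isOpen_dense_isGenericRoots (n := n) α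
  refine ⟨V ∩ (G ∩ _), Set.inter_subset_left, hV.inter (hG.inter hopen),
    (hGdense.inter_of_isOpen_left hdense hG).inter_open_nonempty V hV hne, ?_⟩
  rintro z ⟨hzV, hzG, hcop⟩
  obtain ⟨r, hr⟩ := hroots z hzG
  exact ⟨r, _, _, hr, fun j => .inl (hr.eval_ne_zero_of_isCoprime hcop j), fun j =>
    rootCovector_mem_casimirSpan_sup_coeffSpan hc (hVU hzV) (hr.isRoot j)⟩

lemma exists_isOpen_isSeparatedAt_of_dvd {F : Phase n → ℂ[X]} (hF : IsAnalyticFamily F V)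
    (hV : IsOpen V) (hne : V.Nonempty) (hdvd : ∀ z ∈ V, polyB z ∣ F z)
    (hF0 : ∀ z ∈ V, F z ≠ 0) :
    ∃ W ⊆ V, IsOpen W ∧ W.Nonempty ∧ ∀ z ∈ W, IsSeparatedAt α F z := by
  obtain ⟨W, hWV, hW, hWne, hmem⟩ := exists_isOpen_dB_mem_coeffSpan α hF hV hne hdvd hF0
  refine ⟨W, hWV, hW, hWne, fun z hz => ?_⟩
  obtain ⟨r, hr, hdB⟩ := hmem z hz
  refine ⟨r, 0, 1, hr, fun _ => .inr one_ne_zero, fun j => Submodule.mem_sup_right ?_⟩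
  have hcov : rootCovector 0 1 (r j) = dB (n := n) (r j) := by
    rw [rootCovector]
    module
  exact hcov ▸ hdB j

theorem exists_isOpen_isSeparatedAt_tau (hc : ∀ l, AnalyticOnNhd ℂ (c.coeff l) U)
    (hV : IsOpen V) (hne : V.Nonempty) (hVU : V ⊆ U) (hτ : ∀ z ∈ V, tau α a d c z ≠ 0) :
    ∃ W ⊆ V, IsOpen W ∧ W.Nonempty ∧ ∀ z ∈ W, IsSeparatedAt α (tau α a d c) z := by
  by_cases had : a ≠ 0 ∨ d ≠ 0
  · exact exists_isOpen_isSeparatedAt_of_ne_zero had hc hV hne hVU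
  · obtain ⟨rfl, rfl⟩ : a = 0 ∧ d = 0 := by
      simpa only [not_or, not_not] using had
    refine exists_isOpen_isSeparatedAt_of_dvd ((isAnalyticFamily_tau hc).mono hVU) hV hne
      (fun z _ => ?_) hτ
    rw [tau_eq, zero_mul, zero_mul, zero_add, add_zero]
    exact dvd_mul_left _ _

lemma exists_isOpen_ne_zero_of_fderiv_ne_zero {𝕜 E : Type*} [NontriviallyNormedField 𝕜]
    [NormedAddCommGroup E] [NormedSpace 𝕜 E] {f : E → 𝕜} {V : Set E} (hf : ContinuousOn f V)
    (hV : IsOpen V) {z : E} (hz : z ∈ V) (h : fderiv 𝕜 f z ≠ 0) :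
    ∃ W ⊆ V, IsOpen W ∧ W.Nonempty ∧ ∀ w ∈ W, f w ≠ 0 := by
  refine ⟨V ∩ f ⁻¹' {0}ᶜ, Set.inter_subset_left,
    hf.isOpen_inter_preimage hV isOpen_compl_singleton, ?_, fun w hw => hw.2⟩
  by_contra! hempty
  have hzero : f =ᶠ[𝓝 z] 0 := by
    filter_upwards [hV.mem_nhds hz] with w hw
    by_contra hne
    exact Set.notMem_empty w (hempty ▸ ⟨hw, hne⟩)
  exact h (hzero.fderiv_eq.trans (congrFun fderiv_zero z))

lemma continuousOn_bracket {f g : Phase n → ℂ} (hf : AnalyticOnNhd ℂ f U)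
    (hg : AnalyticOnNhd ℂ g U) (α η : ℂ) (k : Fin 2) : ContinuousOn (bracket α η k f g) U := by
  have hpartial {f : Phase n → ℂ} (hf : AnalyticOnNhd ℂ f U) (i : Gen n) :
      ContinuousOn (partialDeriv i f) U :=
    hf.fderiv.continuousOn.clm_apply continuousOn_const
  refine continuousOn_finsetSum _ fun i _ => continuousOn_finsetSum _ fun j _ =>
    (ContinuousOn.mul ?_ (hpartial hf i)).mul (hpartial hg j)
  simp only [← poisson_proj_proj]
  exact (continuous_poisson α η k _ _).continuousOn

end Involution

end

end ReflectionAlgebra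

open ReflectionAlgebra in
theorem proposition3_general {n : ℕ} (α η : ℂ) (k : Fin 2) {U : Set (Phase n)} (hU : IsOpen U)
    (a d : ℂ[X]) (c : (Phase n → ℂ)[X]) (hc : ∀ l, AnalyticOnNhd ℂ (c.coeff l) U)
    (h : U ⊆ closure {z | z ∈ U ∧ ∃ ω : Fin n → Phase n →L[ℂ] ℂ, ∀ l,
      fderiv ℂ (tauCoeff α a d c l) z ∈ casimirSpan α z ⊔ .span ℂ (Set.range ω)})
    (l m : ℕ) {z : Phase n} (hz : z ∈ U) :
    bracket α η k (tauCoeff α a d c l) (tauCoeff α a d c m) z = 0 := by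
  have hτ : IsAnalyticFamily (tau α a d c) U := isAnalyticFamily_tau hc
  by_contra hne
  let f : Phase n → ℂ := bracket α η k (tauCoeff α a d c l) (tauCoeff α a d c m)
  have hV : IsOpen (U ∩ f ⁻¹' {0}ᶜ) := (continuousOn_bracket (hτ.2 l) (hτ.2 m) α η
    k).isOpen_inter_preimage hU isOpen_compl_singleton
  have hfderiv : fderiv ℂ (tauCoeff α a d c l) z ≠ 0 := fun h0 => hne <| by
    rw [bracket_eq_poisson, h0, map_zero, LinearMap.zero_apply]
  obtain ⟨V', hV'V, hV', hV'ne, hcoeff⟩ := exists_isOpen_ne_zero_of_fderiv_ne_zero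
    ((hτ.2 l).continuousOn.mono Set.inter_subset_left) hV ⟨hz, hne⟩ hfderiv
  obtain ⟨W, hWV', hW, ⟨w, hw⟩, hsep⟩ := exists_isOpen_isSeparatedAt_tau hc hV' hV'ne
    (fun w hw => (hV'V hw).1) fun w hw h0 => hcoeff w hw (by rw [h0, coeff_zero])
  obtain ⟨w', hw', -, ω, hω⟩ := mem_closure_iff.1 (h (hV'V (hWV' hw)).1) W hW hw
  exact (hV'V (hWV' hw')).2 ((hsep w' hw').poisson_eq_zero hω η k l m)

theorem proposition3 (n : ℕ) (α η : ℂ) (U : Set (ReflectionAlgebra.Phase n)) (hU : IsOpen U)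
    (a d : ℂ[X]) (c : (ReflectionAlgebra.Phase n → ℂ)[X])
    (hc : ∀ l : ℕ, AnalyticOnNhd ℂ (c.coeff l) U)
    (e : Fin n → ℕ) (he : ReflectionAlgebra.OnlyIndependentCoeffs α a d c e U) :
    ∀ i j : Fin n, ∀ z ∈ U,
      ReflectionAlgebra.bracket α η 0 (ReflectionAlgebra.tauCoeff α a d c (e i))
          (ReflectionAlgebra.tauCoeff α a d c (e j)) z = 0 ∧
        ReflectionAlgebra.bracket α η 1 (ReflectionAlgebra.tauCoeff α a d c (e i))
          (ReflectionAlgebra.tauCoeff α a d c (e j)) z = 0 := by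
  intro i j z hz
  have hbracket (k : Fin 2) := proposition3_general α η k hU a d c hc
    (he.trans (closure_mono fun _ hw => ⟨hw.1, _, hw.2.2⟩)) (e i) (e j) hz
  exact ⟨hbracket 0, hbracket 1⟩
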